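/- Throughout, $R$ is a commutative ring with $1$ and $\mathcal G$ is a small groupoid with set of identities $\mathcal G_0$; for $g\in\mathcal G$ put $d(g)=g^{-1}g$, $r(g)=gg^{-1}$, and $gh$ exists iff $d(g)=r(h)$. A (small) $R$-semicategory $\mathcal C$ has a set of objects $\mathcal C_0$, $R$-modules ${}_y\mathcal C_x$ of morphisms $x\to y$ and an associative $R$-bilinear composition; it is an $R$-category if every object has an identity. Its algebra is $a(\mathcal C)=\bigoplus_{x,y}{}_y\mathcal C_x$ with the matrix product. An ideal of $\mathcal C$ is a family of submodules ${}_y\mathcal I_x\subseteq{}_y\mathcal C_x$ closed under composition on either side with morphisms of $\mathcal C$. A partial action of $\mathcal G$ on a set $X$ consists of subsets $X^g\subseteq X^{r(g)}\subseteq X$ and bijections $\alpha_g:X^{g^{-1}}\to X^g$, with $X=\bigcup_{e\in\mathcal G_0}X^e$, $\alpha_e=\mathrm{id}$ for $e\in\mathcal G_0$, and, whenever $gh$ exists, $\alpha_g(X^{g^{-1}}\cap X^h)=X^g\cap X^{gh}$ and $\alpha_g\alpha_h=\alpha_{gh}$ wherever the left side is defined. It is global if $\alpha_g\alpha_h=\alpha_{gh}$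 as partial maps. A globalization of $X$ is a set $Y$ with a global action and an injection $\iota:X\to Y$ such that $gx$ is defined iff $g\iota(x)$ is defined and lies in $\iota(X)$, and then $\iota(gx)=g\iota(x)$; it is universal if it maps equivariantly and compatibly with the embeddings of $X$ in exactly one way to every globalization. A partial action $\alpha=(\mathcal I^g,\alpha^g)_{g\in\mathcal G}$ of $\mathcal G$ on $\mathcal C$ consists of a partial action $(\mathcal C_0^g,\alpha_0^g)$ on $\mathcal C_0$ (written $x\mapsto gx$), ideals $\mathcal I^g\unlhd\mathcal I^{r(g)}\unlhd\mathcal C$ with ${}_y\mathcal I^g_x=0$ unless $x,y\in\mathcal C_0^g$, and isomorphisms $\alpha^g:\mathcal I^{g^{-1}}\to\mathcal I^g$ ($R$-linear bijections ${}_y\mathcal I^{g^{-1}}_x\to{}_{gy}\mathcal I^g_{gx}$ for $x,y\in \mathcal C_0^{g^{-1}}$, compatible with composition), with $\alpha^e=\mathrm{id}$ for $e\in\mathcal G_0$, $\alpha^{h^{-1}}(\mathcal I^h\cap\mathcal I^{g^{-1}})\subseteq\mathcal I^{(gh)^{-1}}$, and $\alpha^g\alpha^h=\alpha^{gh}$ on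 $\alpha^{h^{-1}}(\mathcal I^h\cap\mathcal I^{g^{-1}})$, whenever $gh$ exists. It is global if $\alpha^g\alpha^h=\alpha^{gh}$ as partial maps on objects and on morphisms. A partial action $\beta=(\mathcal J^g,\beta^g)_{g\in\mathcal G}$ on $\mathcal T$ is a globalization of $\alpha$ if it is global; its action on $\mathcal T_0$ is a universal globalization of that on $\mathcal C_0$ along some $\iota$; and for each $e\in\mathcal G_0$ there is an $R$-linear faithful semifunctor $\varphi_e:\mathcal I^e\to\mathcal J^e$, equal to $\iota$ on objects, with image an ideal of $\mathcal J^e$, such that for all $g\in \mathcal G$ - $\varphi_{r(g)}({}_y\mathcal I^g_x)=\varphi_{r(g)}({}_y\mathcal I^{r(g)}_x)\cap\beta^g(\varphi_{d(g)}({}_{g^{-1}y}\mathcal I^{d(g)}_{g^{-1}x}))$ for $x,y\in\mathcal C_0^g$; - $\beta^g\varphi_{d(g)}=\varphi_{r(g)}\alpha^g$ on $\mathcal I^{g^{-1}}$; - ${}_v\mathcal J^g_u=\sum_{r(h)=r(g)}\beta^h(\varphi_{d(h)}({}_{h^{-1}v}\mathcal I^{d(h)}_{h^{-1}u}))$ for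 $u,v\in\mathcal T_0$, where a summand is $0$ unless $h^{-1}u,h^{-1}v$ are defined and lie in $\iota(\mathcal C_0)$, which is identified with $\mathcal C_0$. A partial action of $\mathcal G$ on a ring $A$ consists of ideals $A_g\unlhd A_{r(g)}\unlhd A$ and ring isomorphisms $\alpha_g:A_{g^{-1}}\to A_g$ with $\alpha_e=\mathrm{id}$ for $e\in\mathcal G_0$, $\alpha_h^{-1}(A_{g^{-1}}\cap A_h)\subseteq A_{(gh)^{-1}}$, and $\alpha_g\alpha_h=\alpha_{gh}$ on $\alpha_h^{-1}(A_{g^{-1}}\cap A_h)$, whenever $gh$ exists; it is global if $\alpha_g\alpha_h=\alpha_{gh}$ as partial maps. A global action $(B_g,\beta_g)$ on a ring $B$ is a globalization of it if there are ring monomorphisms $\psi_e:A_e\to B_e$ ($e\in\mathcal G_0$) with $\psi_e(A_e)\unlhd B_e$, $\psi_{r(g)}(A_g)=\psi_{r(g)}(A_{r(g)})\cap\beta_g(\psi_{d(g)}(A_{d(g)}))$, $\beta_g\psi_{d(g)}=\psi_{r(g)}\alpha_g$ on $A_{g^{-1}}$, and $B_g=\sum_{r(h)=r(g)}\beta_h(\psi_{d(h)}(A_{d(h)}))$.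 A partial action $\alpha$ on $\mathcal C$ induces a partial action $\alpha_{a(\mathcal C)}$ on $a(\mathcal C)$, with $a(\mathcal C)_g=\bigoplus_{x,y}{}_y\mathcal I^g_x$ and $\alpha_g$ acting as $\alpha^g$ on each summand. The skew structure $\mathcal C\star_\alpha\mathcal G$ has objects $\mathcal C_0$, morphisms ${}_y(\mathcal C\star_\alpha\mathcal G)_x=\bigoplus_{g:\,x\in\mathcal C_0^{g^{-1}}}{}_y\mathcal I^g_{gx}$, and the $R$-bilinear composition which sends $f\in{}_z\mathcal I^t_{ty}$, $l\in{}_y\mathcal I^g_{gx}$ to $\alpha^t(\alpha^{t^{-1}}(f)\,l)\in{}_z\mathcal I^{tg}_{(tg)x}$ if $tg$ exists and $x\in\mathcal C_0^{(tg)^{-1}}$, and to $0$ otherwise; $\alpha$ is called associative if this composition is. Two (possibly non-unital) rings are Morita equivalent if both are idempotent ($A^2=A$) and their categories of left modules $M$ with $AM=M$ and $\{m\in M: Am=0\}=0$ are equivalent. **Theorem.** Let $\mathcal C$ and $\mathcal T$ be $R$-categories, and let $\alpha$ and $\beta$ be partial actions of $\mathcal G$ on $\mathcal C$ and $\mathcal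 T$ such that $(\mathcal T,\beta)$ is a globalization of $\alpha$. Then $\beta_{a(\mathcal T)}$ is a global action of $\mathcal G$ on $a(\mathcal T)$, $\alpha_{a(\mathcal C)}$ is a partial action of $\mathcal G$ on $a(\mathcal C)$, and $\beta_{a(\mathcal T)}$ is a globalization of $\alpha_{a(\mathcal C)}$. If moreover $\alpha$ and $\beta$ are associative and, for all $e\in\mathcal G_0$ and $x\in\mathcal C_0$, ${}_x\mathcal I^e_x$ contains a left local identity (an element $u$ with $uf=f$ for all $y\in\mathcal C_0$ and $f\in{}_x\mathcal I^e_y$), then $a(\mathcal C\star_\alpha\mathcal G)$ and $a(\mathcal T\star_\beta\mathcal G)$ are Morita equivalent. -/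

import Mathlib

open CategoryTheory
open scoped DirectSum

universe u w

/-! ## Semicategories enriched in `R`-modules -/

/-- Objects, `R`-modules of morphisms and an `R`-bilinear composition, not assumed associative or
unital.  `Hom x y` is the module of morphisms from `x` to `y` (written `_y C_x` on paper), and
`comp f l` is the composite `f l` ("first `l`, then `f`"). -/
structure PreSemicat (R : Type w) [CommRing R] where
  Obj : Type u
  Hom : Obj → Obj → Type u
  [addCommGroup : ∀ x y, AddCommGroup (Hom x y)]
  [module : ∀ x y, Module R (Hom x y)]
  comp : ∀ {x y z : Obj}, Hom y z →ₗ[R] Hom x y →ₗ[R] Hom x z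

attribute [instance] PreSemicat.addCommGroup PreSemicat.module

namespace PreSemicat

variable {R : Type w} [CommRing R]

/-- An `R`-semicategory: the composition is associative. -/
class IsSemicategory (C : PreSemicat.{u} R) : Prop where
  assoc : ∀ {x y z t : C.Obj} (f : C.Hom z t) (l : C.Hom y z) (k : C.Hom x y),
    C.comp (C.comp f l) k = C.comp f (C.comp l k)

/-- An `R`-category: an `R`-semicategory in which every object has an identity morphism. -/
class IsCategory (C : PreSemicat.{u} R) : Prop extends C.IsSemicategory where
  exists_id : ∀ x : C.Obj, ∃ e : C.Hom x x,
    (∀ (y : C.Obj) (f : C.Hom x y), C.comp f e = f) ∧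
    (∀ (y : C.Obj) (f : C.Hom y x), C.comp e f = f)

/-- A morphism together with its source and target, used to compare morphisms whose sources and
targets are only provably equal. -/
structure Morph (C : PreSemicat.{u} R) where
  src : C.Obj
  tgt : C.Obj
  hom : C.Hom src tgt

/-- Transport of morphisms along equalities of source and target. -/
def castHom (C : PreSemicat.{u} R) {x x' y y' : C.Obj} (hx : x = x') (hy : y = y') :
    C.Hom x y →ₗ[R] C.Hom x' y' := by
  subst hx
  subst hy
  exact LinearMap.id

theorem castHom_mem (C : PreSemicat.{u} R) (I : ∀ x y, Submodule R (C.Hom x y))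
    {x x' y y' : C.Obj} (hx : x = x') (hy : y = y') {f : C.Hom x y} (hf : f ∈ I x y) :
    C.castHom hx hy f ∈ I x' y' := by
  subst hx
  subst hy
  exact hf

/-! ### The algebra of a semicategory -/

/-- The `R`-module `a(C)`, the direct sum of all the modules of morphisms. -/
def Alg (C : PreSemicat.{u} R) : Type u := ⨁ p : C.Obj × C.Obj, C.Hom p.1 p.2

noncomputable instance (C : PreSemicat.{u} R) : AddCommGroup C.Alg :=
  inferInstanceAs (AddCommGroup (⨁ p : C.Obj × C.Obj, C.Hom p.1 p.2))

noncomputable instance (C : PreSemicat.{u} R) : Module R C.Alg :=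
  inferInstanceAs (Module R (⨁ p : C.Obj × C.Obj, C.Hom p.1 p.2))

/-- The component of an element of `a(C)` in `Hom x y`. -/
noncomputable def coeff (C : PreSemicat.{u} R) (x y : C.Obj) : C.Alg →ₗ[R] C.Hom x y :=
  DirectSum.component R (C.Obj × C.Obj) (fun p => C.Hom p.1 p.2) (x, y)

open Classical in
/-- The inclusion of `Hom x y` in `a(C)`. -/
noncomputable def single (C : PreSemicat.{u} R) (x y : C.Obj) : C.Hom x y →ₗ[R] C.Alg :=
  DirectSum.lof R (C.Obj × C.Obj) (fun p => C.Hom p.1 p.2) (x, y)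

open Classical in
/-- The pairs of objects at which an element of `a(C)` has a nonzero component. -/
noncomputable def support {C : PreSemicat.{u} R} (w : C.Alg) : Finset (C.Obj × C.Obj) :=
  DFinsupp.support (β := fun p : C.Obj × C.Obj => C.Hom p.1 p.2) w

open Classical in
/-- The product in `a(C)` of a morphism from `x` to `y` with a morphism from `x'` to `y'`: the
composite if `y' = x`, and zero otherwise. -/
noncomputable def mulSingle (C : PreSemicat.{u} R) (x y x' y' : C.Obj) :
    C.Hom x y →ₗ[R] C.Hom x' y' →ₗ[R] C.Alg :=
  if h : y' = x then
    (C.comp (x := x') (y := x) (z := y)).compr₂ (C.single x' y) |>.compl₂ (C.castHom rfl h)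
  else 0

open Classical in
/-- The matrix product of `a(C)`. -/
noncomputable def mulAlg (C : PreSemicat.{u} R) : C.Alg →ₗ[R] C.Alg →ₗ[R] C.Alg :=
  DirectSum.toModule R (C.Obj × C.Obj) (C.Alg →ₗ[R] C.Alg) fun p =>
    (DirectSum.toModule R (C.Obj × C.Obj) (C.Hom p.1 p.2 →ₗ[R] C.Alg) fun q =>
      (C.mulSingle p.1 p.2 q.1 q.2).flip).flip

noncomputable instance (C : PreSemicat.{u} R) : NonUnitalNonAssocRing C.Alg :=
  { (inferInstance : AddCommGroup C.Alg) with
    mul := fun a b => C.mulAlg a b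
    left_distrib := fun a b c => map_add (C.mulAlg a) b c
    right_distrib := fun a b c => by
      change C.mulAlg (a + b) c = C.mulAlg a c + C.mulAlg b c
      simp
    zero_mul := fun a => by
      change C.mulAlg 0 a = 0
      simp
    mul_zero := fun a => map_zero (C.mulAlg a) }

theorem mul_eq_mulAlg (C : PreSemicat.{u} R) (a b : C.Alg) : a * b = C.mulAlg a b := rfl

theorem single_mul_single (C : PreSemicat.{u} R) {x y x' y' : C.Obj}
    (f : C.Hom x y) (l : C.Hom x' y') :
    C.single x y f * C.single x' y' l = C.mulSingle x y x' y' f l := by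
  classical
  rw [mul_eq_mulAlg]
  unfold mulAlg single
  erw [DirectSum.toModule_lof]
  have h2 := DirectSum.toModule_lof R (M := fun p : C.Obj × C.Obj => C.Hom p.1 p.2)
    (φ := fun q : C.Obj × C.Obj => (C.mulSingle x y q.1 q.2).flip) (x', y') l
  exact LinearMap.congr_fun h2 f

theorem single_mul_single_eq (C : PreSemicat.{u} R) {x y z : C.Obj}
    (f : C.Hom y z) (l : C.Hom x y) :
    C.single y z f * C.single x y l = C.single x z (C.comp f l) := by
  rw [single_mul_single, mulSingle, dif_pos rfl]
  rfl

theorem single_mul_single_ne (C : PreSemicat.{u} R) {x y x' y' : C.Obj} (h : y' ≠ x)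
    (f : C.Hom x y) (l : C.Hom x' y') :
    C.single x y f * C.single x' y' l = 0 := by
  rw [single_mul_single, mulSingle, dif_neg h]
  rfl

theorem alg_induction (C : PreSemicat.{u} R) {P : C.Alg → Prop} (a : C.Alg) (h0 : P 0)
    (hs : ∀ (x y : C.Obj) (f : C.Hom x y), P (C.single x y f))
    (ha : ∀ a b, P a → P b → P (a + b)) : P a := by
  classical
  exact DirectSum.induction_on a h0 (fun p f => hs p.1 p.2 f) ha

noncomputable instance (C : PreSemicat.{u} R) [C.IsSemicategory] : NonUnitalRing C.Alg :=
  { (inferInstance : NonUnitalNonAssocRing C.Alg) with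
    mul_assoc := by
      intro a b c
      induction a using C.alg_induction with
      | h0 => simp
      | ha a a' h h' => simp only [add_mul, h, h']
      | hs z t f =>
        induction b using C.alg_induction with
        | h0 => simp
        | ha b b' h h' => simp only [add_mul, mul_add, h, h']
        | hs y z' l =>
          induction c using C.alg_induction with
          | h0 => simp
          | ha c c' h h' => simp only [mul_add, h, h']
          | hs x y' k =>
            by_cases h1 : z' = z
            · subst h1
              by_cases h2 : y' = y
              · subst h2
                simp only [single_mul_single_eq, IsSemicategory.assoc]
              · rw [single_mul_single_eq, single_mul_single_ne C h2, single_mul_single_ne C h2,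
                  mul_zero]
            · rw [single_mul_single_ne C h1, zero_mul]
              by_cases h2 : y' = y
              · subst h2
                rw [single_mul_single_eq, single_mul_single_ne C h1]
              · rw [single_mul_single_ne C h2, mul_zero] }

end PreSemicat

/-! ## Partial actions of groupoids

A groupoid `Γ` is a Mathlib groupoid; its objects are the identities.  For `g : a ⟶ b` the domain
identity `d(g)` is `𝟙 a`, the range identity `r(g)` is `𝟙 b`, and the product `g h` of `h : a ⟶ b`
and `g : b ⟶ c` is `h ≫ g`. -/

/-- A partial action of `Γ` on a set: subsets `D g` and bijections `act g : D g⁻¹ → D g`.  The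
values of `act g` outside `D g⁻¹` carry no meaning and are never used. -/
structure PartialSetAction (Γ : Type u) [Groupoid.{u} Γ] (X : Type u) where
  D : ∀ {a b : Γ}, (a ⟶ b) → Set X
  act : ∀ {a b : Γ}, (a ⟶ b) → X → X
  subset_range : ∀ {a b : Γ} (g : a ⟶ b), D g ⊆ D (𝟙 b)
  bijOn : ∀ {a b : Γ} (g : a ⟶ b), Set.BijOn (act g) (D (inv g)) (D g)
  cover : ∀ x : X, ∃ a : Γ, x ∈ D (𝟙 a)
  act_id : ∀ (a : Γ), ∀ x ∈ D (𝟙 a), act (𝟙 a) x = x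
  image_inter : ∀ {a b c : Γ} (g : b ⟶ c) (h : a ⟶ b),
    act g '' (D (inv g) ∩ D h) = D g ∩ D (h ≫ g)
  act_act : ∀ {a b c : Γ} (g : b ⟶ c) (h : a ⟶ b) (x : X), x ∈ D (inv h) →
    act h x ∈ D (inv g) → act g (act h x) = act (h ≫ g) x

namespace PartialSetAction

variable {Γ : Type u} [Groupoid.{u} Γ] {X Y : Type u}

/-- The action is global: `act g ∘ act h = act (g h)` as partial functions. -/
def IsGlobal (α : PartialSetAction Γ X) : Prop :=
  ∀ {a b c : Γ} (g : b ⟶ c) (h : a ⟶ b) (x : X),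
    (x ∈ α.D (inv (h ≫ g)) ↔ x ∈ α.D (inv h) ∧ α.act h x ∈ α.D (inv g)) ∧
    (x ∈ α.D (inv (h ≫ g)) → α.act g (α.act h x) = α.act (h ≫ g) x)

/-- `β` is a globalization of `α` along `ι`: `β` is a global action, `ι` is injective, and `α` is
the restriction of `β` to the image of `ι`. -/
structure IsGlobalization (α : PartialSetAction Γ X) (β : PartialSetAction Γ Y) (ι : X → Y) :
    Prop where
  global : β.IsGlobal
  injective : Function.Injective ι
  mem_iff : ∀ {a b : Γ} (g : a ⟶ b) (x : X),
    x ∈ α.D (inv g) ↔ ι x ∈ β.D (inv g) ∧ β.act g (ι x) ∈ Set.range ι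
  map_act : ∀ {a b : Γ} (g : a ⟶ b), ∀ x ∈ α.D (inv g), ι (α.act g x) = β.act g (ι x)

/-- A map of sets with partial actions: if `g x` is defined then so is `g (k x)`, and it equals
`k (g x)`. -/
def IsEquivariant (α : PartialSetAction Γ X) (β : PartialSetAction Γ Y) (k : X → Y) : Prop :=
  ∀ {a b : Γ} (g : a ⟶ b), ∀ x ∈ α.D (inv g), k x ∈ β.D (inv g) ∧ k (α.act g x) = β.act g (k x)

/-- A globalization that maps uniquely to every globalization. -/
structure IsUniversalGlobalization (α : PartialSetAction Γ X) (β : PartialSetAction Γ Y)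
    (ι : X → Y) : Prop extends α.IsGlobalization β ι where
  universal : ∀ (Z : Type u) (γ : PartialSetAction Γ Z) (j : X → Z), α.IsGlobalization γ j →
    ∃! k : Y → Z, β.IsEquivariant γ k ∧ k ∘ ι = j

theorem act_mem (α : PartialSetAction Γ X) {a b : Γ} (g : a ⟶ b) {x : X}
    (hx : x ∈ α.D (inv g)) : α.act g x ∈ α.D g := (α.bijOn g).mapsTo hx

theorem act_inv_act (α : PartialSetAction Γ X) {a b : Γ} (g : a ⟶ b) {x : X}
    (hx : x ∈ α.D (inv g)) : α.act (inv g) (α.act g x) = x := by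
  have h := α.act_act (inv g) g x hx (by simpa using α.act_mem g hx)
  rw [IsIso.hom_inv_id] at h
  rw [h]
  exact α.act_id a x (α.subset_range (inv g) hx)

theorem act_act_inv (α : PartialSetAction Γ X) {a b : Γ} (g : a ⟶ b) {x : X}
    (hx : x ∈ α.D g) : α.act g (α.act (inv g) x) = x := by
  have hx' : x ∈ α.D (inv (inv g)) := by simpa using hx
  have h := α.act_act g (inv g) x hx' (α.act_mem (inv g) hx')
  rw [IsIso.inv_hom_id] at h
  rw [h]
  exact α.act_id b x (α.subset_range g hx)

theorem act_mem_of_comp (α : PartialSetAction Γ X) {a b c : Γ} (t : b ⟶ c) (g : a ⟶ b) {x : X}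
    (hx : x ∈ α.D (inv g)) (hx' : x ∈ α.D (inv (g ≫ t))) : α.act g x ∈ α.D (inv t) := by
  have h := α.image_inter (inv g) (inv t)
  have hm : x ∈ α.D (inv g) ∩ α.D (inv t ≫ inv g) := ⟨hx, by simpa using hx'⟩
  rw [← h] at hm
  obtain ⟨z, ⟨hz1, hz2⟩, rfl⟩ := hm
  rw [α.act_act_inv g (by simpa using hz1)]
  exact hz2

end PartialSetAction

/-- A partial action of a groupoid `Γ` on `C`: a partial action `obj` on the objects, submodules
`I g x y` of the modules of morphisms forming ideals `I g ⊴ I (r(g)) ⊴ C`, vanishing outside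
`D g`, and `R`-linear isomorphisms `map g : I g⁻¹ → I g`, compatible with compositions, sending
morphisms from `x` to `y` to morphisms from `g x` to `g y`.  (Only the values of `map g` at objects
of `D g⁻¹` carry a meaning.)

The last two fields are the conditions on `g h`.  The inclusion
`α^{h⁻¹}(I^h ∩ I^{g⁻¹}) ⊆ I^{(g h)⁻¹}` is written with `(g, h)` in the place of `(h⁻¹, g⁻¹)`.  As
`map h⁻¹` is inverse to `map h`, `f ∈ α^{h⁻¹}(I^h ∩ I^{g⁻¹})` says that `f` is in `I^{h⁻¹}` and
`α^h f` is in `I^{g⁻¹}`. -/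
structure PartialAction {R : Type w} [CommRing R] (Γ : Type u) [Groupoid.{u} Γ]
    (C : PreSemicat.{u} R) where
  obj : PartialSetAction Γ C.Obj
  I : ∀ {a b : Γ} (_ : a ⟶ b) (x y : C.Obj), Submodule R (C.Hom x y)
  eq_bot : ∀ {a b : Γ} (g : a ⟶ b) (x y : C.Obj), ¬ (x ∈ obj.D g ∧ y ∈ obj.D g) → I g x y = ⊥
  ideal_left : ∀ (a : Γ) {x y z : C.Obj} (k : C.Hom y z), ∀ f ∈ I (𝟙 a) x y,
    C.comp k f ∈ I (𝟙 a) x z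
  ideal_right : ∀ (a : Γ) {x y z : C.Obj}, ∀ f ∈ I (𝟙 a) y z, ∀ k : C.Hom x y,
    C.comp f k ∈ I (𝟙 a) x z
  le_range : ∀ {a b : Γ} (g : a ⟶ b) (x y : C.Obj), I g x y ≤ I (𝟙 b) x y
  ideal_range_left : ∀ {a b : Γ} (g : a ⟶ b) {x y z : C.Obj},
    ∀ k ∈ I (𝟙 b) y z, ∀ f ∈ I g x y, C.comp k f ∈ I g x z
  ideal_range_right : ∀ {a b : Γ} (g : a ⟶ b) {x y z : C.Obj},
    ∀ f ∈ I g y z, ∀ k ∈ I (𝟙 b) x y, C.comp f k ∈ I g x z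
  map : ∀ {a b : Γ} (g : a ⟶ b) {x y : C.Obj},
    I (inv g) x y →ₗ[R] I g (obj.act g x) (obj.act g y)
  map_bijective : ∀ {a b : Γ} (g : a ⟶ b) {x y : C.Obj}, x ∈ obj.D (inv g) → y ∈ obj.D (inv g) →
    Function.Bijective (map g (x := x) (y := y))
  map_comp : ∀ {a b : Γ} (g : a ⟶ b) {x y z : C.Obj},
    x ∈ obj.D (inv g) → y ∈ obj.D (inv g) → z ∈ obj.D (inv g) →
    ∀ (f : I (inv g) y z) (k : I (inv g) x y) (hfk : C.comp f.1 k.1 ∈ I (inv g) x z),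
      (map g ⟨C.comp f.1 k.1, hfk⟩).1 = C.comp (map g f).1 (map g k).1
  map_id : ∀ (a : Γ) {x y : C.Obj}, x ∈ obj.D (𝟙 a) → y ∈ obj.D (𝟙 a) →
    ∀ f : I (inv (𝟙 a)) x y, (⟨_, _, (map (𝟙 a) f).1⟩ : C.Morph) = ⟨x, y, f.1⟩
  map_mem : ∀ {a b c : Γ} (g : b ⟶ c) (h : a ⟶ b) {x y : C.Obj} (f : I (inv g) x y),
    f.1 ∈ I h x y → (map g f).1 ∈ I (h ≫ g) (obj.act g x) (obj.act g y)
  map_map : ∀ {a b c : Γ} (g : b ⟶ c) (h : a ⟶ b) {x y : C.Obj},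
    x ∈ obj.D (inv h) → y ∈ obj.D (inv h) →
    obj.act h x ∈ obj.D (inv g) → obj.act h y ∈ obj.D (inv g) →
    ∀ (f : I (inv h) x y) (hg : (map h f).1 ∈ I (inv g) (obj.act h x) (obj.act h y))
      (hgh : f.1 ∈ I (inv (h ≫ g)) x y),
      (⟨_, _, (map g ⟨(map h f).1, hg⟩).1⟩ : C.Morph) = ⟨_, _, (map (h ≫ g) ⟨f.1, hgh⟩).1⟩

namespace PartialAction

variable {R : Type w} [CommRing R] {Γ : Type u} [Groupoid.{u} Γ] {C T : PreSemicat.{u} R}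

/-- The partial action is global: `α^g α^h = α^{g h}` as partial maps, on objects and on morphisms.
(On morphisms the two sides agree wherever both are defined, so only the domains matter.) -/
structure IsGlobal (α : PartialAction Γ C) : Prop where
  obj : α.obj.IsGlobal
  mem_iff : ∀ {a b c : Γ} (g : b ⟶ c) (h : a ⟶ b) {x y : C.Obj},
    x ∈ α.obj.D (inv (h ≫ g)) → y ∈ α.obj.D (inv (h ≫ g)) → ∀ f : C.Hom x y,
    f ∈ α.I (inv (h ≫ g)) x y ↔ ∃ hf : f ∈ α.I (inv h) x y,
      (α.map h ⟨f, hf⟩).1 ∈ α.I (inv g) (α.obj.act h x) (α.obj.act h y)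

/-- `(T, β)` is a globalization of `(C, α)`.  The semifunctors `φ e : I^e → J^e` act on objects
through the embedding `ι` of the objects of `C` in those of `T`. -/
structure Globalization (α : PartialAction Γ C) (β : PartialAction Γ T) where
  global : β.IsGlobal
  ι : C.Obj → T.Obj
  universal : α.obj.IsUniversalGlobalization β.obj ι
  φ : ∀ (e : Γ) {x y : C.Obj}, α.I (𝟙 e) x y →ₗ[R] β.I (𝟙 e) (ι x) (ι y)
  φ_comp : ∀ (e : Γ) {x y z : C.Obj} (f : α.I (𝟙 e) y z) (k : α.I (𝟙 e) x y)
    (hfk : C.comp f.1 k.1 ∈ α.I (𝟙 e) x z),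
    (φ e ⟨C.comp f.1 k.1, hfk⟩).1 = T.comp (φ e f).1 (φ e k).1
  φ_faithful : ∀ (e : Γ) {x y : C.Obj}, Function.Injective (φ e (x := x) (y := y))
  /-- `φ e (I^e)` (with the zero morphisms between the remaining objects) is an ideal of `J^e`. -/
  φ_ideal_left : ∀ (e : Γ) {x y : C.Obj} {v : T.Obj} (f : α.I (𝟙 e) x y),
    ∀ k ∈ β.I (𝟙 e) (ι y) v, T.comp k (φ e f).1 = 0 ∨
      ∃ (x' y' : C.Obj) (f' : α.I (𝟙 e) x' y'),
        (⟨_, _, T.comp k (φ e f).1⟩ : T.Morph) = ⟨_, _, (φ e f').1⟩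
  φ_ideal_right : ∀ (e : Γ) {x y : C.Obj} {v : T.Obj} (f : α.I (𝟙 e) x y),
    ∀ k ∈ β.I (𝟙 e) v (ι x), T.comp (φ e f).1 k = 0 ∨
      ∃ (x' y' : C.Obj) (f' : α.I (𝟙 e) x' y'),
        (⟨_, _, T.comp (φ e f).1 k⟩ : T.Morph) = ⟨_, _, (φ e f').1⟩
  /-- `φ (I^g) = φ (I^{r(g)}) ∩ β^g (φ (I^{d(g)}))` at objects of `D g`. -/
  φ_inter : ∀ {a b : Γ} (g : a ⟶ b) {x y : C.Obj}, x ∈ α.obj.D g → y ∈ α.obj.D g →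
    ∀ k : T.Hom (ι x) (ι y),
      (∃ f : α.I (𝟙 b) x y, f.1 ∈ α.I g x y ∧ (φ b f).1 = k) ↔
      (∃ f : α.I (𝟙 b) x y, (φ b f).1 = k) ∧
      ∃ (f' : α.I (𝟙 a) (α.obj.act (inv g) x) (α.obj.act (inv g) y))
        (hf' : (φ a f').1 ∈ β.I (inv g) (ι (α.obj.act (inv g) x)) (ι (α.obj.act (inv g) y))),
        (⟨_, _, k⟩ : T.Morph) = ⟨_, _, (β.map g ⟨(φ a f').1, hf'⟩).1⟩
  /-- `β^g ∘ φ = φ ∘ α^g` on `I^{g⁻¹}`. -/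
  map_φ : ∀ {a b : Γ} (g : a ⟶ b) {x y : C.Obj},
    x ∈ α.obj.D (inv g) → y ∈ α.obj.D (inv g) → ∀ f : α.I (inv g) x y,
    ∃ hf : (φ a ⟨f.1, α.le_range (inv g) x y f.2⟩).1 ∈ β.I (inv g) (ι x) (ι y),
      (⟨_, _, (β.map g ⟨_, hf⟩).1⟩ : T.Morph) =
        ⟨_, _, (φ b ⟨(α.map g f).1, α.le_range g _ _ (α.map g f).2⟩).1⟩
  /-- `J^g` is the sum of the `β^h (φ (I^{d(h)}))` over all `h` with `r(h) = r(g)`. -/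
  eq_sum : ∀ {a b : Γ} (g : a ⟶ b) (u v : T.Obj),
    β.I g u v = Submodule.span R {k : T.Hom u v |
      ∃ (c : Γ) (h : c ⟶ b) (x y : C.Obj) (f : α.I (𝟙 c) x y)
        (hf : (φ c f).1 ∈ β.I (inv h) (ι x) (ι y)),
        (⟨_, _, k⟩ : T.Morph) = ⟨_, _, (β.map h ⟨(φ c f).1, hf⟩).1⟩}

/-- `(T, β)` is a globalization of `(C, α)`. -/
def IsGlobalization (α : PartialAction Γ C) (β : PartialAction Γ T) : Prop :=
  Nonempty (Globalization α β)

/-- Every `I^e` has left local identities: for each object `x` there is a morphism `i` in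
`I^e` from `x` to `x` with `i f = f` for all `f` in `I^e` with target `x`. -/
def HasLeftLocalIdentities (α : PartialAction Γ C) : Prop :=
  ∀ (e : Γ) (x : C.Obj), ∃ i ∈ α.I (𝟙 e) x x,
    ∀ (y : C.Obj), ∀ f ∈ α.I (𝟙 e) y x, C.comp i f = f

end PartialAction

/-! ## Partial actions of groupoids on rings -/

/-- Additive subgroups `D g` of `A` and maps `act g : D g⁻¹ → A`. -/
structure RingActionData (Γ : Type u) [Groupoid.{u} Γ] (A : Type u) [NonUnitalRing A] where
  D : ∀ {a b : Γ}, (a ⟶ b) → AddSubgroup A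
  act : ∀ {a b : Γ} (g : a ⟶ b), D (inv g) → A

namespace RingActionData

variable {Γ : Type u} [Groupoid.{u} Γ] {A B : Type u} [NonUnitalRing A] [NonUnitalRing B]

/-- The data form a partial action of `Γ` on the ring `A`: `D (r(g))` is an ideal of `A`, `D g` is
an ideal of `D (r(g))`, `act g` is a ring isomorphism of `D g⁻¹` onto `D g`, etc. -/
structure IsPartialAction (α : RingActionData Γ A) : Prop where
  ideal_left : ∀ (a : Γ) (s : A), ∀ x ∈ α.D (𝟙 a), s * x ∈ α.D (𝟙 a)
  ideal_right : ∀ (a : Γ), ∀ x ∈ α.D (𝟙 a), ∀ s : A, x * s ∈ α.D (𝟙 a)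
  le_range : ∀ {a b : Γ} (g : a ⟶ b), α.D g ≤ α.D (𝟙 b)
  ideal_range_left : ∀ {a b : Γ} (g : a ⟶ b), ∀ s ∈ α.D (𝟙 b), ∀ x ∈ α.D g, s * x ∈ α.D g
  ideal_range_right : ∀ {a b : Γ} (g : a ⟶ b), ∀ x ∈ α.D g, ∀ s ∈ α.D (𝟙 b), x * s ∈ α.D g
  injective : ∀ {a b : Γ} (g : a ⟶ b), Function.Injective (α.act g)
  range_eq : ∀ {a b : Γ} (g : a ⟶ b), Set.range (α.act g) = α.D g
  map_add : ∀ {a b : Γ} (g : a ⟶ b) (x y : α.D (inv g)), α.act g (x + y) = α.act g x + α.act g y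
  map_mul : ∀ {a b : Γ} (g : a ⟶ b) (x y : α.D (inv g)) (hxy : x.1 * y.1 ∈ α.D (inv g)),
    α.act g ⟨x.1 * y.1, hxy⟩ = α.act g x * α.act g y
  act_id : ∀ (a : Γ) (x : α.D (inv (𝟙 a))), α.act (𝟙 a) x = x.1
  mem_comp : ∀ {a b c : Γ} (g : b ⟶ c) (h : a ⟶ b) (x : α.D (inv h)),
    α.act h x ∈ α.D (inv g) → x.1 ∈ α.D (inv (h ≫ g))
  act_act : ∀ {a b c : Γ} (g : b ⟶ c) (h : a ⟶ b) (x : α.D (inv h))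
    (hg : α.act h x ∈ α.D (inv g)) (hgh : x.1 ∈ α.D (inv (h ≫ g))),
    α.act g ⟨α.act h x, hg⟩ = α.act (h ≫ g) ⟨x.1, hgh⟩

/-- A global action: a partial action with `act g ∘ act h = act (g h)` as partial maps (the two
sides agree wherever both are defined, so only the domains matter). -/
structure IsGlobalAction (α : RingActionData Γ A) : Prop extends α.IsPartialAction where
  mem_iff : ∀ {a b c : Γ} (g : b ⟶ c) (h : a ⟶ b) (x : A),
    x ∈ α.D (inv (h ≫ g)) ↔ ∃ hx : x ∈ α.D (inv h), α.act h ⟨x, hx⟩ ∈ α.D (inv g)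

/-- `β` is a global action of `Γ` on `B` and a globalization of the partial action `α` on `A`. -/
structure IsGlobalization (α : RingActionData Γ A) (β : RingActionData Γ B) : Prop where
  partialAction : α.IsPartialAction
  global : β.IsGlobalAction
  /-- the ring monomorphisms `ψ e : A_e → B_e` -/
  exists_mono : ∃ ψ : ∀ e : Γ, α.D (𝟙 e) →+ β.D (𝟙 e),
    (∀ e, Function.Injective (ψ e)) ∧
    (∀ (e : Γ) (x y : α.D (𝟙 e)) (hxy : x.1 * y.1 ∈ α.D (𝟙 e)),
      (ψ e ⟨x.1 * y.1, hxy⟩).1 = (ψ e x).1 * (ψ e y).1) ∧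
    -- the image of `ψ e` is an ideal of `B_e`
    (∀ (e : Γ) (x : α.D (𝟙 e)), ∀ s ∈ β.D (𝟙 e),
      (∃ y, (ψ e y).1 = s * (ψ e x).1) ∧ (∃ y, (ψ e y).1 = (ψ e x).1 * s)) ∧
    -- `ψ (A_g) = ψ (A_{r(g)}) ∩ β_g (ψ (A_{d(g)}))`
    (∀ {a b : Γ} (g : a ⟶ b) (z : B),
      (∃ x : α.D (𝟙 b), x.1 ∈ α.D g ∧ (ψ b x).1 = z) ↔
      (∃ x : α.D (𝟙 b), (ψ b x).1 = z) ∧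
      ∃ (x : α.D (𝟙 a)) (hx : (ψ a x).1 ∈ β.D (inv g)), β.act g ⟨(ψ a x).1, hx⟩ = z) ∧
    -- `β_g (ψ x) = ψ (α_g x)` for `x` in `A_{g⁻¹}`
    (∀ {a b : Γ} (g : a ⟶ b) (x : α.D (inv g)),
      ∃ (hx : x.1 ∈ α.D (𝟙 a)) (hx' : (ψ a ⟨x.1, hx⟩).1 ∈ β.D (inv g))
        (hgx : α.act g x ∈ α.D (𝟙 b)),
        β.act g ⟨(ψ a ⟨x.1, hx⟩).1, hx'⟩ = (ψ b ⟨α.act g x, hgx⟩).1) ∧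
    -- `B_g` is the sum of the `β_h (ψ (A_{d(h)}))` over all `h` with `r(h) = r(g)`
    (∀ {a b : Γ} (g : a ⟶ b), β.D g = AddSubgroup.closure {z : B |
      ∃ (c : Γ) (h : c ⟶ b) (x : α.D (𝟙 c)) (hx : (ψ c x).1 ∈ β.D (inv h)),
        z = β.act h ⟨(ψ c x).1, hx⟩})

end RingActionData

namespace PartialAction

variable {R : Type w} [CommRing R] {Γ : Type u} [Groupoid.{u} Γ] {C T : PreSemicat.{u} R}

/-- The partial action on the algebra `a(C)` induced by a partial action on `C`: `a(C)_g` is the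
direct sum of the `I g x y`, and `g` acts componentwise by `map g`. -/
noncomputable def onAlg [C.IsSemicategory] (α : PartialAction Γ C) : RingActionData Γ C.Alg where
  D g :=
    { carrier := {w | ∀ x y, C.coeff x y w ∈ α.I g x y}
      add_mem' := fun ha hb x y => by
        rw [map_add]
        exact (α.I g x y).add_mem (ha x y) (hb x y)
      zero_mem' := fun x y => by
        rw [map_zero]
        exact (α.I g x y).zero_mem
      neg_mem' := fun ha x y => by
        rw [map_neg]
        exact (α.I g x y).neg_mem (ha x y) }
  act g w := ∑ p ∈ PreSemicat.support w.1,
    C.single (α.obj.act g p.1) (α.obj.act g p.2)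
      (α.map g ⟨C.coeff p.1 p.2 w.1, w.2 p.1 p.2⟩).1

/-! ### The partial skew groupoid semicategory -/

/-- The elements `g` of `Γ` for which `g x` is defined. -/
structure Defined (α : PartialAction Γ C) (x : C.Obj) : Type u where
  dom : Γ
  cod : Γ
  hom : dom ⟶ cod
  mem : x ∈ α.obj.D (inv hom)

/-- The morphisms from `x` to `y` in `C ⋆ Γ`: the direct sum, over the `g` for which `g x` is
defined, of the morphisms in `I g` from `g x` to `y`. -/
abbrev SkewHom (α : PartialAction Γ C) (x y : C.Obj) : Type u :=
  ⨁ p : α.Defined x, α.I p.hom (α.obj.act p.hom x) y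

/-- The morphism `α^{t⁻¹} f`, for `f` in `I t` from `t y` to `z`. -/
noncomputable def pull (α : PartialAction Γ C) {b c : Γ} (t : b ⟶ c) {y z : C.Obj}
    (hy : y ∈ α.obj.D (inv t)) :
    α.I t (α.obj.act t y) z →ₗ[R] α.I (inv t) y (α.obj.act (inv t) z) :=
  ((C.castHom (α.obj.act_inv_act t hy) rfl).comp
    ((α.I (inv t) _ _).subtype.comp
      ((α.map (inv t) (x := α.obj.act t y) (y := z)).comp
        (Submodule.inclusion (by rw [IsIso.inv_inv]))))).codRestrict _ (fun f =>
    C.castHom_mem (fun x y => α.I (inv t) x y) _ _ (Subtype.prop _))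

/-- The composite of a morphism in `I t⁻¹` and a morphism in `I g`, where `d(t) = r(g)`; it lies in
both of these ideals. -/
noncomputable def compInter (α : PartialAction Γ C) {a b c : Γ} (t : b ⟶ c) (g : a ⟶ b)
    {x y z : C.Obj} :
    α.I (inv t) y z →ₗ[R] α.I g x y →ₗ[R] ↥(α.I (inv t) x z ⊓ α.I g x z) :=
  LinearMap.mk₂ R
    (fun f l => ⟨C.comp f.1 l.1, α.ideal_range_right (inv t) _ f.2 _ (α.le_range g _ _ l.2),
      α.ideal_range_left g _ (α.le_range (inv t) _ _ f.2) _ l.2⟩)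
    (fun f f' l => Subtype.ext (by simp))
    (fun r f l => Subtype.ext (by simp))
    (fun f l l' => Subtype.ext (by simp))
    (fun r f l => Subtype.ext (by simp))

/-- The map `α^t` from `I t⁻¹ ∩ I g` to `I (t g)`, at objects where `t g` and `t` are defined as
required for the product of `C ⋆ Γ`. -/
noncomputable def mapInter (α : PartialAction Γ C) {a b c : Γ} (t : b ⟶ c) (g : a ⟶ b)
    {x z : C.Obj} (hx : x ∈ α.obj.D (inv g)) (hxt : x ∈ α.obj.D (inv (g ≫ t)))
    (hz : z ∈ α.obj.D t) :
    ↥(α.I (inv t) (α.obj.act g x) (α.obj.act (inv t) z) ⊓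
      α.I g (α.obj.act g x) (α.obj.act (inv t) z)) →ₗ[R] α.I (g ≫ t) (α.obj.act (g ≫ t) x) z :=
  ((C.castHom (α.obj.act_act t g x hx (α.obj.act_mem_of_comp t g hx hxt))
      (α.obj.act_act_inv t hz)).comp
    ((α.I t _ _).subtype.comp
      ((α.map t).comp (Submodule.inclusion inf_le_left)))).codRestrict _ (fun f =>
    C.castHom_mem (fun x y => α.I (g ≫ t) x y) _ _ (α.map_mem t g _ f.2.2))

/-- The product `α^t (α^{t⁻¹}(f) l)` in `I (t g)`, for `f` in `I t` from `t y` to `z` and `l` in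
`I g` from `g x` to `y`, where `(t g) x` is defined and `z` is in `D t`. -/
noncomputable def skewMul (α : PartialAction Γ C) {a b c : Γ} (t : b ⟶ c) (g : a ⟶ b)
    {x y z : C.Obj} (hx : x ∈ α.obj.D (inv g)) (hy : y ∈ α.obj.D (inv t))
    (hxt : x ∈ α.obj.D (inv (g ≫ t))) (hz : z ∈ α.obj.D t) :
    α.I t (α.obj.act t y) z →ₗ[R] α.I g (α.obj.act g x) y →ₗ[R]
      α.I (g ≫ t) (α.obj.act (g ≫ t) x) z :=
  ((α.compInter t g).compr₂ (α.mapInter t g hx hxt hz)).comp (α.pull t hy)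

open Classical in
/-- The product in `C ⋆ Γ` of the summand of `t` with the summand of `g`; it is zero unless
`t g` exists and `(t g) x` is defined.  (If `z` is not in `D t` then `f` is zero.) -/
noncomputable def skewComp₂ (α : PartialAction Γ C) {a b b' c : Γ} (t : b' ⟶ c) (g : a ⟶ b)
    {x y z : C.Obj} (hx : x ∈ α.obj.D (inv g)) (hy : y ∈ α.obj.D (inv t)) :
    α.I t (α.obj.act t y) z →ₗ[R] α.I g (α.obj.act g x) y →ₗ[R] α.SkewHom x z :=
  if h : b = b' then by
    subst h
    exact if hxz : x ∈ α.obj.D (inv (g ≫ t)) ∧ z ∈ α.obj.D t then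
      (α.skewMul t g hx hy hxz.1 hxz.2).compr₂
        (DirectSum.lof R (α.Defined x) (fun p => α.I p.hom (α.obj.act p.hom x) z)
          ⟨a, c, g ≫ t, hxz.1⟩)
    else 0
  else 0

open Classical in
/-- The skew groupoid semicategory `C ⋆ Γ`, not necessarily associative. -/
noncomputable def skew (α : PartialAction Γ C) : PreSemicat.{u} R where
  Obj := C.Obj
  Hom := α.SkewHom
  comp {x y z} :=
    DirectSum.toModule R (α.Defined y) (α.SkewHom x y →ₗ[R] α.SkewHom x z) fun p =>
      (DirectSum.toModule R (α.Defined x)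
        (α.I p.hom (α.obj.act p.hom y) z →ₗ[R] α.SkewHom x z) fun q =>
          (α.skewComp₂ p.hom q.hom q.mem p.mem).flip).flip

/-- The partial action is associative: the composition of `C ⋆ Γ` is associative. -/
abbrev IsAssociative (α : PartialAction Γ C) : Prop := α.skew.IsSemicategory

end PartialAction

/-! ## Morita equivalence of idempotent rings -/

/-- A left module `M` over a possibly non-unital ring `A` which is unital (`A M = M`) and
torsion-free (`A m = 0` only for `m = 0`). -/
structure UnitalModule (A : Type u) [NonUnitalRing A] where
  carrier : Type u
  [addCommGroup : AddCommGroup carrier]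
  smul : A →ₙ+* AddMonoid.End carrier
  unital : AddSubgroup.closure {m : carrier | ∃ (a : A) (n : carrier), smul a n = m} = ⊤
  torsionFree : ∀ m : carrier, (∀ a : A, smul a m = 0) → m = 0

attribute [instance] UnitalModule.addCommGroup

namespace UnitalModule

variable {A : Type u} [NonUnitalRing A]

/-- `A`-linear maps. -/
@[ext]
structure Hom (M N : UnitalModule A) where
  toFun : M.carrier →+ N.carrier
  map_smul : ∀ (a : A) (m : M.carrier), toFun (M.smul a m) = N.smul a (toFun m)

/-- The category of unital torsion-free left `A`-modules and `A`-linear maps. -/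
instance : Category (UnitalModule A) where
  Hom := Hom
  id M := ⟨AddMonoidHom.id _, fun _ _ => rfl⟩
  comp f g := ⟨g.toFun.comp f.toFun, fun a m => by
    simp only [AddMonoidHom.comp_apply, f.map_smul, g.map_smul]⟩

end UnitalModule

/-- `A A = A`. -/
def IsIdempotentRing (A : Type u) [NonUnitalRing A] : Prop :=
  AddSubgroup.closure {c : A | ∃ a b : A, a * b = c} = ⊤

/-- Morita equivalence of possibly non-unital rings: both rings are idempotent, and their categories
of unital torsion-free left modules are equivalent. -/
structure MoritaEquivalent (A B : Type u) [NonUnitalRing A] [NonUnitalRing B] : Prop where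
  idempotent_left : IsIdempotentRing A
  idempotent_right : IsIdempotentRing B
  equivalence : Nonempty (UnitalModule A ≌ UnitalModule B)

/-!
The ring part is checked componentwise. Each `α^g` and each `φ e` is a faithful semifunctor defined
on a family of submodules and injective on the relevant objects (`PartialSemifunctor`), so it
extends to an injective multiplicative map between the corresponding parts of `a(C)` and `a(T)`
(`PartialSemifunctor.alg`). Every condition on the algebras reduces to the condition on single
morphisms; zero morphisms, about whose objects nothing is known, are always treated apart. The
conclusion is `PartialAction.Globalization.onAlg_isGlobalization`.

For the Morita equivalence, write `f δ_g` for a homogeneous element of a skew algebra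
(`PartialAction.delta`). For a global action `f δ_t · l δ_g = f β^t(l) δ_{t g}`
(`PartialAction.IsGlobal.delta_mul`). In `B = a(T ⋆ Γ)` let `M` be the span of the `φ(f) δ_g` with
`f` in `I^{r(g)}` and `N` the span of the `β^g(φ(f)) δ_g` with `f` in `I^{d(g)}`. Since the images
of the `φ e` are ideals, `M` is a right ideal and `N` is a left ideal. The map `f δ_g ↦ φ(f) δ_g`
embeds `A = a(C ⋆ Γ)` in `B`, with image in `M ∩ N`, and `M N` is contained in this image because
`φ(I^g) = φ(I^{r(g)}) ∩ β^g(φ(I^{d(g)}))`. Finally `N M = B`, because `J^g` is generated by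
translates of the `φ(f)` and `f = i f` for a left local identity `i`; finite sums of such `i` are
also left units for any given element of `M`.

In this situation (`CornerContext`) the functor `X ↦ M X`, from `B`-modules to `A`-modules, is an
equivalence. Local units take the place of tensor products: `M X` is a subgroup of `X`, and an
`A`-module `Y` comes from the group of functions on `M` generated by the `m ↦ (m n) y`, with `n` in
`N` and `y` in `Y`.
-/

namespace PreSemicat

variable {R : Type w} [CommRing R] {C T : PreSemicat.{u} R}

/-! ### Coordinates in the algebra of a semicategory -/

theorem coeff_single_self (x y : C.Obj) (f : C.Hom x y) :
    C.coeff x y (C.single x y f) = f := by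
  classical
  exact DirectSum.component.lof_self R (M := fun p : C.Obj × C.Obj => C.Hom p.1 p.2) (x, y) f

theorem coeff_single_of_ne {x y x' y' : C.Obj} (h : ¬(x = x' ∧ y = y')) (f : C.Hom x y) :
    C.coeff x' y' (C.single x y f) = 0 := by
  classical
  refine (DirectSum.component.of R (M := fun p : C.Obj × C.Obj => C.Hom p.1 p.2)
    (x', y') (x, y) f).trans (dif_neg ?_)
  simpa [Prod.ext_iff, eq_comm] using h

theorem alg_ext {a b : C.Alg} (h : ∀ x y, C.coeff x y a = C.coeff x y b) : a = b :=
  DirectSum.ext_component R fun p => h p.1 p.2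

theorem notMem_support {w : C.Alg} {p : C.Obj × C.Obj} :
    p ∉ support w ↔ C.coeff p.1 p.2 w = 0 := by
  classical
  exact DFinsupp.notMem_support_iff

theorem sum_single_coeff (w : C.Alg) :
    ∑ p ∈ support w, C.single p.1 p.2 (C.coeff p.1 p.2 w) = w := by
  classical
  exact DirectSum.sum_support_of (β := fun p : C.Obj × C.Obj => C.Hom p.1 p.2) w

theorem support_single_subset (x y : C.Obj) (f : C.Hom x y) :
    support (C.single x y f) ⊆ {(x, y)} := by
  classical
  intro p hp
  by_contra hne
  refine notMem_support.2 (coeff_single_of_ne (fun h => hne ?_) f) hp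
  simp [h.1, h.2]

/-- The elements of `a(C)` with all components in the given submodules. -/
def subAlg (I : ∀ x y, Submodule R (C.Hom x y)) : Submodule R C.Alg where
  carrier := {w | ∀ x y, C.coeff x y w ∈ I x y}
  add_mem' ha hb x y := by
    rw [map_add]
    exact (I x y).add_mem (ha x y) (hb x y)
  zero_mem' x y := by
    rw [map_zero]
    exact (I x y).zero_mem
  smul_mem' r _ ha x y := by
    rw [map_smul]
    exact (I x y).smul_mem r (ha x y)

theorem single_mem_subAlg {I : ∀ x y, Submodule R (C.Hom x y)} {x y : C.Obj} {f : C.Hom x y}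
    (hf : f ∈ I x y) : C.single x y f ∈ subAlg I := by
  intro x' y'
  by_cases h : x = x' ∧ y = y'
  · obtain ⟨rfl, rfl⟩ := h
    rwa [coeff_single_self]
  · rw [coeff_single_of_ne h]
    exact zero_mem _

theorem subAlg_mono {I J : ∀ x y, Submodule R (C.Hom x y)} (h : ∀ x y, I x y ≤ J x y) :
    subAlg I ≤ subAlg J := fun _ hw x y => h x y (hw x y)

theorem subAlg_induction {I : ∀ x y, Submodule R (C.Hom x y)}
    {P : ∀ w : C.Alg, w ∈ subAlg I → Prop}
    (h0 : P 0 (zero_mem _))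
    (hs : ∀ (x y : C.Obj) (f : C.Hom x y) (hf : f ∈ I x y),
      P (C.single x y f) (single_mem_subAlg hf))
    (ha : ∀ (a : C.Alg) (ha : a ∈ subAlg I) (b : C.Alg) (hb : b ∈ subAlg I),
      P a ha → P b hb → P (a + b) (add_mem ha hb)) {w : C.Alg} (hw : w ∈ subAlg I) : P w hw := by
  classical
  have key : ∀ S : Finset (C.Obj × C.Obj),
      ∃ h, P (∑ p ∈ S, C.single p.1 p.2 (C.coeff p.1 p.2 w)) h := by
    intro S
    induction S using Finset.induction_on with
    | empty => simpa using h0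
    | insert p S hp ih =>
      obtain ⟨h2, ih⟩ := ih
      have h1 := single_mem_subAlg (hw p.1 p.2)
      simp only [Finset.sum_insert hp]
      exact ⟨add_mem h1 h2, ha _ h1 _ h2 (hs _ _ _ (hw p.1 p.2)) ih⟩
  obtain ⟨h, hP⟩ := key (support w)
  simpa only [sum_single_coeff] using hP

/-- The element of `a(C)` given by a single morphism. -/
noncomputable def Morph.toAlg (k : C.Morph) : C.Alg := C.single k.src k.tgt k.hom

/-- Equalities in `a(C)` follow from equalities of morphisms whose sources and targets agree only
propositionally. -/
theorem single_congr {x y x' y' : C.Obj} {f : C.Hom x y} {f' : C.Hom x' y'}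
    (h : (⟨x, y, f⟩ : C.Morph) = ⟨x', y', f'⟩) : C.single x y f = C.single x' y' f' :=
  congrArg Morph.toAlg h

theorem hom_eq_zero_of_eq {x y : C.Obj} {k : C.Morph} (h : k = ⟨x, y, 0⟩) : k.hom = 0 := by
  subst h
  rfl

theorem morph_castHom {x x' y y' : C.Obj} (hx : x = x') (hy : y = y') (f : C.Hom x y) :
    (⟨x', y', C.castHom hx hy f⟩ : C.Morph) = ⟨x, y, f⟩ := by
  subst hx hy
  rfl

theorem morph_comp_congr {x y z x' y' z' : C.Obj} {f : C.Hom y z} {f' : C.Hom y' z'}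
    {l : C.Hom x y} {l' : C.Hom x' y'} (h : (⟨y, z, f⟩ : C.Morph) = ⟨y', z', f'⟩)
    (h' : (⟨x, y, l⟩ : C.Morph) = ⟨x', y', l'⟩) :
    (⟨x, z, C.comp f l⟩ : C.Morph) = ⟨x', z', C.comp f' l'⟩ := by
  cases h
  cases h'
  rfl

theorem mul_mem_subAlg {I J K : ∀ x y, Submodule R (C.Hom x y)}
    (h : ∀ {x y z : C.Obj}, ∀ f ∈ I y z, ∀ l ∈ J x y, C.comp f l ∈ K x z) {a b : C.Alg}
    (ha : a ∈ subAlg I) (hb : b ∈ subAlg J) : a * b ∈ subAlg K := by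
  induction ha using subAlg_induction with
  | h0 => simp
  | ha a _ a' _ h1 h2 =>
    rw [add_mul]
    exact add_mem h1 h2
  | hs y z f hf =>
    induction hb using subAlg_induction with
    | h0 => simp
    | ha b _ b' _ h1 h2 =>
      rw [mul_add]
      exact add_mem h1 h2
    | hs x y' l hl =>
      by_cases hy : y' = y
      · subst hy
        rw [single_mul_single_eq]
        exact single_mem_subAlg (h f hf l hl)
      · rw [single_mul_single_ne C hy]
        exact zero_mem _

end PreSemicat

open PreSemicat

/-! ### Partially defined semifunctors -/

/-- A faithful `R`-linear semifunctor defined on a part of `C`: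
submodules `dom x y` of the modules of morphisms, closed under composition and vanishing unless
`x` and `y` lie in `carrier`, a map of objects which is injective on `carrier`, and injective linear
maps on the `dom x y` compatible with composition. -/
structure PartialSemifunctor {R : Type w} [CommRing R] (C T : PreSemicat.{u} R) where
  obj : C.Obj → T.Obj
  carrier : Set C.Obj
  dom : ∀ x y : C.Obj, Submodule R (C.Hom x y)
  map : ∀ {x y : C.Obj}, dom x y →ₗ[R] T.Hom (obj x) (obj y)
  injOn : Set.InjOn obj carrier
  dom_eq_bot : ∀ x y, ¬ (x ∈ carrier ∧ y ∈ carrier) → dom x y = ⊥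
  map_injective : ∀ {x y : C.Obj}, x ∈ carrier → y ∈ carrier →
    Function.Injective (map (x := x) (y := y))
  comp_mem : ∀ {x y z : C.Obj}, ∀ f ∈ dom y z, ∀ l ∈ dom x y, C.comp f l ∈ dom x z
  map_comp : ∀ {x y z : C.Obj}, x ∈ carrier → y ∈ carrier → z ∈ carrier →
    ∀ (f : dom y z) (l : dom x y) (h : C.comp f.1 l.1 ∈ dom x z),
      map ⟨C.comp f.1 l.1, h⟩ = T.comp (map f) (map l)

namespace PartialSemifunctor

variable {R : Type w} [CommRing R] {C T : PreSemicat.{u} R} (F : PartialSemifunctor C T)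

open Classical in
/-- The action on morphisms, extended by zero outside the domain. -/
noncomputable def hom {x y : C.Obj} (f : C.Hom x y) : T.Hom (F.obj x) (F.obj y) :=
  if h : f ∈ F.dom x y then F.map ⟨f, h⟩ else 0

theorem hom_of_mem {x y : C.Obj} {f : C.Hom x y} (h : f ∈ F.dom x y) : F.hom f = F.map ⟨f, h⟩ :=
  dif_pos h

theorem mem_carrier_of_ne_zero {x y : C.Obj} {f : C.Hom x y} (h : f ∈ F.dom x y) (h0 : f ≠ 0) :
    x ∈ F.carrier ∧ y ∈ F.carrier := by
  by_contra hne
  rw [F.dom_eq_bot x y hne] at h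
  exact h0 h

@[simp]
theorem hom_zero {x y : C.Obj} : F.hom (0 : C.Hom x y) = 0 := by
  rw [F.hom_of_mem (zero_mem _)]
  exact map_zero F.map

theorem hom_add {x y : C.Obj} {f f' : C.Hom x y} (h : f ∈ F.dom x y) (h' : f' ∈ F.dom x y) :
    F.hom (f + f') = F.hom f + F.hom f' := by
  rw [F.hom_of_mem h, F.hom_of_mem h', F.hom_of_mem (add_mem h h'), ← map_add]
  rfl

theorem hom_smul {x y : C.Obj} (r : R) {f : C.Hom x y} (h : f ∈ F.dom x y) :
    F.hom (r • f) = r • F.hom f := by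
  rw [F.hom_of_mem h, F.hom_of_mem (Submodule.smul_mem _ r h), ← map_smul]
  rfl

theorem hom_inj {x y : C.Obj} {f f' : C.Hom x y} (h : f ∈ F.dom x y) (h' : f' ∈ F.dom x y)
    (he : F.hom f = F.hom f') : f = f' := by
  by_cases hc : x ∈ F.carrier ∧ y ∈ F.carrier
  · rw [F.hom_of_mem h, F.hom_of_mem h'] at he
    exact congrArg Subtype.val (F.map_injective hc.1 hc.2 he)
  · rw [F.dom_eq_bot x y hc, Submodule.mem_bot] at h h'
    rw [h, h']

theorem hom_comp {x y z : C.Obj} {f : C.Hom y z} {l : C.Hom x y} (hf : f ∈ F.dom y z)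
    (hl : l ∈ F.dom x y) : F.hom (C.comp f l) = T.comp (F.hom f) (F.hom l) := by
  by_cases hf0 : f = 0
  · simp [hf0]
  by_cases hl0 : l = 0
  · simp [hl0]
  have h1 := F.mem_carrier_of_ne_zero hf hf0
  have h2 := F.mem_carrier_of_ne_zero hl hl0
  rw [F.hom_of_mem hf, F.hom_of_mem hl, F.hom_of_mem (F.comp_mem f hf l hl)]
  exact F.map_comp h2.1 h1.1 h1.2 ⟨f, hf⟩ ⟨l, hl⟩ _

/-- The action on morphisms with variable source and target. -/
noncomputable def onMorph (k : C.Morph) : T.Morph := ⟨F.obj k.src, F.obj k.tgt, F.hom k.hom⟩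

theorem onMorph_zero (x y : C.Obj) : F.onMorph ⟨x, y, 0⟩ = ⟨F.obj x, F.obj y, 0⟩ :=
  congrArg (Morph.mk _ _) F.hom_zero

theorem onMorph_comp {x y z : C.Obj} {f : C.Hom y z} {l : C.Hom x y} (hf : f ∈ F.dom y z)
    (hl : l ∈ F.dom x y) :
    F.onMorph ⟨x, z, C.comp f l⟩ = ⟨F.obj x, F.obj z, T.comp (F.hom f) (F.hom l)⟩ :=
  congrArg (Morph.mk _ _) (F.hom_comp hf hl)

/-- The componentwise extension to the algebras. -/
noncomputable def alg (w : C.Alg) : T.Alg :=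
  ∑ p ∈ support w, T.single (F.obj p.1) (F.obj p.2) (F.hom (C.coeff p.1 p.2 w))

theorem alg_eq_sum {w : C.Alg} {S : Finset (C.Obj × C.Obj)} (h : support w ⊆ S) :
    F.alg w = ∑ p ∈ S, T.single (F.obj p.1) (F.obj p.2) (F.hom (C.coeff p.1 p.2 w)) := by
  refine Finset.sum_subset h fun p _ hp => ?_
  rw [notMem_support.1 hp, hom_zero, map_zero]

@[simp]
theorem alg_zero : F.alg 0 = 0 := by
  rw [F.alg_eq_sum (Finset.Subset.refl _)]
  simp

theorem alg_add {a b : C.Alg} (ha : a ∈ subAlg F.dom) (hb : b ∈ subAlg F.dom) :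
    F.alg (a + b) = F.alg a + F.alg b := by
  classical
  set S := support (a + b) ∪ (support a ∪ support b)
  have h1 : support (a + b) ⊆ S := Finset.subset_union_left
  have h2 : support a ⊆ S := Finset.subset_union_left.trans Finset.subset_union_right
  have h3 : support b ⊆ S := Finset.subset_union_right.trans Finset.subset_union_right
  rw [F.alg_eq_sum h1, F.alg_eq_sum h2, F.alg_eq_sum h3, ← Finset.sum_add_distrib]
  refine Finset.sum_congr rfl fun p _ => ?_
  rw [map_add, F.hom_add (ha p.1 p.2) (hb p.1 p.2), map_add]

theorem alg_single {x y : C.Obj} (f : C.Hom x y) :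
    F.alg (C.single x y f) = T.single (F.obj x) (F.obj y) (F.hom f) := by
  rw [F.alg_eq_sum (support_single_subset x y f), Finset.sum_singleton, coeff_single_self]

theorem alg_mem {J : ∀ u v, Submodule R (T.Hom u v)} {w : C.Alg} (hw : w ∈ subAlg F.dom)
    (h : ∀ x y, ∀ f ∈ F.dom x y, F.hom f ∈ J (F.obj x) (F.obj y)) : F.alg w ∈ subAlg J :=
  sum_mem fun p _ => single_mem_subAlg (h _ _ _ (hw p.1 p.2))

/-- As the objects are mapped injectively, components are not mixed. -/
theorem coeff_alg {w : C.Alg} (hw : w ∈ subAlg F.dom) {x y : C.Obj} (hx : x ∈ F.carrier)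
    (hy : y ∈ F.carrier) : T.coeff (F.obj x) (F.obj y) (F.alg w) = F.hom (C.coeff x y w) := by
  induction hw using subAlg_induction with
  | h0 => simp
  | ha a ha b hb iha ihb =>
    rw [F.alg_add ha hb, map_add, map_add, F.hom_add (ha x y) (hb x y), iha, ihb]
  | hs x' y' f hf =>
    rw [F.alg_single]
    by_cases h0 : f = 0
    · simp [h0]
    obtain ⟨hx', hy'⟩ := F.mem_carrier_of_ne_zero hf h0
    by_cases h : x' = x ∧ y' = y
    · obtain ⟨rfl, rfl⟩ := h
      rw [coeff_single_self, coeff_single_self]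
    · rw [coeff_single_of_ne h, coeff_single_of_ne, hom_zero]
      exact fun h' => h ⟨F.injOn hx' hx h'.1, F.injOn hy' hy h'.2⟩

theorem exists_of_coeff_alg_ne_zero {w : C.Alg} (hw : w ∈ subAlg F.dom) {u v : T.Obj}
    (h : T.coeff u v (F.alg w) ≠ 0) :
    ∃ x ∈ F.carrier, ∃ y ∈ F.carrier, F.obj x = u ∧ F.obj y = v := by
  by_contra hne
  refine h ?_
  rw [alg, map_sum]
  refine Finset.sum_eq_zero fun p _ => ?_
  by_cases h0 : C.coeff p.1 p.2 w = 0
  · simp [h0]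
  · obtain ⟨hx, hy⟩ := F.mem_carrier_of_ne_zero (hw p.1 p.2) h0
    exact coeff_single_of_ne (fun h' => hne ⟨p.1, hx, p.2, hy, h'⟩) _

theorem alg_inj {a b : C.Alg} (ha : a ∈ subAlg F.dom) (hb : b ∈ subAlg F.dom)
    (h : F.alg a = F.alg b) : a = b := by
  refine alg_ext fun x y => F.hom_inj (ha x y) (hb x y) ?_
  by_cases hc : x ∈ F.carrier ∧ y ∈ F.carrier
  · rw [← F.coeff_alg ha hc.1 hc.2, ← F.coeff_alg hb hc.1 hc.2, h]
  · have ha' := ha x y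
    have hb' := hb x y
    rw [F.dom_eq_bot x y hc, Submodule.mem_bot] at ha' hb'
    rw [ha', hb']

theorem alg_mul {a b : C.Alg} (ha : a ∈ subAlg F.dom) (hb : b ∈ subAlg F.dom) :
    F.alg (a * b) = F.alg a * F.alg b := by
  have hm := @F.comp_mem
  induction ha using subAlg_induction with
  | h0 => simp
  | ha a ha a' ha' h1 h2 =>
    rw [add_mul, F.alg_add (mul_mem_subAlg hm ha hb) (mul_mem_subAlg hm ha' hb),
      F.alg_add ha ha', h1, h2, add_mul]
  | hs y z f hf =>
    induction hb using subAlg_induction with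
    | h0 => simp
    | ha b hb b' hb' h1 h2 =>
      have hs := single_mem_subAlg hf
      rw [mul_add, F.alg_add (mul_mem_subAlg hm hs hb) (mul_mem_subAlg hm hs hb'),
        F.alg_add hb hb', h1, h2, mul_add]
    | hs x y' l hl =>
      by_cases hf0 : f = 0
      · simp [hf0]
      by_cases hl0 : l = 0
      · simp [hl0]
      have h1 := F.mem_carrier_of_ne_zero hf hf0
      have h2 := F.mem_carrier_of_ne_zero hl hl0
      rw [F.alg_single, F.alg_single]
      by_cases hy : y' = y
      · subst hy
        rw [single_mul_single_eq, single_mul_single_eq, F.alg_single, F.hom_comp hf hl]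
      · rw [single_mul_single_ne C hy, single_mul_single_ne T, alg_zero]
        exact fun h => hy (F.injOn h2.2 h1.1 h)

end PartialSemifunctor

namespace PartialAction

variable {R : Type w} [CommRing R] {Γ : Type u} [Groupoid.{u} Γ] {C T : PreSemicat.{u} R}
  (α : PartialAction Γ C)

/-! ### The isomorphisms of a partial action -/

/-- The isomorphism `α^g` as a partially defined semifunctor. -/
noncomputable abbrev semi {a b : Γ} (g : a ⟶ b) : PartialSemifunctor C C where
  obj := α.obj.act g
  carrier := α.obj.D (inv g)
  dom := α.I (inv g)
  map := (Submodule.subtype _).comp (α.map g)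
  injOn := (α.obj.bijOn g).injOn
  dom_eq_bot := α.eq_bot (inv g)
  map_injective hx hy := Subtype.val_injective.comp (α.map_bijective g hx hy).injective
  comp_mem f hf l hl := α.ideal_range_left (inv g) f (α.le_range (inv g) _ _ hf) l hl
  map_comp hx hy hz f l h := α.map_comp g hx hy hz f l h

theorem semi_hom {a b : Γ} (g : a ⟶ b) {x y : C.Obj} {f : C.Hom x y} (hf : f ∈ α.I (inv g) x y) :
    (α.semi g).hom f = (α.map g ⟨f, hf⟩).1 := (α.semi g).hom_of_mem hf

theorem onMorph_mk {a b : Γ} (g : a ⟶ b) {x y : C.Obj} {f : C.Hom x y}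
    (hf : f ∈ α.I (inv g) x y) :
    (α.semi g).onMorph ⟨x, y, f⟩ = ⟨_, _, (α.map g ⟨f, hf⟩).1⟩ :=
  congrArg (Morph.mk _ _) (α.semi_hom g hf)

theorem hom_mem {a b : Γ} (g : a ⟶ b) {x y : C.Obj} {f : C.Hom x y} (hf : f ∈ α.I (inv g) x y) :
    (α.semi g).hom f ∈ α.I g (α.obj.act g x) (α.obj.act g y) := by
  rw [α.semi_hom g hf]
  exact (α.map g ⟨f, hf⟩).2

theorem mem_D_of_ne_zero {a b : Γ} (g : a ⟶ b) {x y : C.Obj} {f : C.Hom x y}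
    (hf : f ∈ α.I g x y) (h0 : f ≠ 0) : x ∈ α.obj.D g ∧ y ∈ α.obj.D g := by
  by_contra hne
  rw [α.eq_bot g x y hne] at hf
  exact h0 hf

theorem hom_mem_comp {a b c : Γ} (g : b ⟶ c) (h : a ⟶ b) {x y : C.Obj} {f : C.Hom x y}
    (hf : f ∈ α.I (inv g) x y) (hf' : f ∈ α.I h x y) :
    (α.semi g).hom f ∈ α.I (h ≫ g) (α.obj.act g x) (α.obj.act g y) := by
  rw [α.semi_hom g hf]
  exact α.map_mem g h ⟨f, hf⟩ hf'

/-- An element of `I^{h⁻¹} ∩ I^{(g h)⁻¹}` is sent by `α^h` into `I^{g⁻¹}`, because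
`h (g h)⁻¹ = g⁻¹`. -/
theorem hom_mem_of_mem_comp {a b c : Γ} (g : b ⟶ c) (h : a ⟶ b) {x y : C.Obj} {f : C.Hom x y}
    (hf : f ∈ α.I (inv h) x y) (hf' : f ∈ α.I (inv (h ≫ g)) x y) :
    (α.semi h).hom f ∈ α.I (inv g) (α.obj.act h x) (α.obj.act h y) := by
  simpa using α.hom_mem_comp h (inv (h ≫ g)) hf hf'

theorem onMorph_id (a : Γ) {x y : C.Obj} {f : C.Hom x y} (hx : x ∈ α.obj.D (𝟙 a))
    (hy : y ∈ α.obj.D (𝟙 a)) (hf : f ∈ α.I (𝟙 a) x y) :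
    (α.semi (𝟙 a)).onMorph ⟨x, y, f⟩ = ⟨x, y, f⟩ := by
  have hf' : f ∈ α.I (inv (𝟙 a)) x y := by simpa using hf
  exact (α.onMorph_mk (𝟙 a) hf').trans (α.map_id a hx hy ⟨f, hf'⟩)

/-- `α^g α^h = α^{g h}` on `I^{h⁻¹} ∩ I^{(g h)⁻¹}`; by `hom_mem_of_mem_comp` the left side is defined
there. -/
theorem onMorph_onMorph {a b c : Γ} (g : b ⟶ c) (h : a ⟶ b) {x y : C.Obj} {f : C.Hom x y}
    (hx : x ∈ α.obj.D (inv h)) (hy : y ∈ α.obj.D (inv h))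
    (hx' : x ∈ α.obj.D (inv (h ≫ g))) (hy' : y ∈ α.obj.D (inv (h ≫ g)))
    (hf : f ∈ α.I (inv h) x y) (hf' : f ∈ α.I (inv (h ≫ g)) x y) :
    (α.semi g).onMorph ((α.semi h).onMorph ⟨x, y, f⟩) = (α.semi (h ≫ g)).onMorph ⟨x, y, f⟩ := by
  have hm := α.hom_mem_of_mem_comp g h hf hf'
  rw [α.semi_hom h hf] at hm
  rw [α.onMorph_mk h hf, α.onMorph_mk g hm, α.onMorph_mk (h ≫ g) hf']
  exact α.map_map g h hx hy (α.obj.act_mem_of_comp g h hx hx')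
    (α.obj.act_mem_of_comp g h hy hy') ⟨f, hf⟩ hm hf'

theorem onMorph_inv_onMorph {a b : Γ} (g : a ⟶ b) {x y : C.Obj} {f : C.Hom x y}
    (hx : x ∈ α.obj.D (inv g)) (hy : y ∈ α.obj.D (inv g)) (hf : f ∈ α.I (inv g) x y) :
    (α.semi (inv g)).onMorph ((α.semi g).onMorph ⟨x, y, f⟩) = ⟨x, y, f⟩ := by
  have e : ∀ {k : a ⟶ a}, k = 𝟙 a → ∀ {x}, x ∈ α.obj.D (inv g) → x ∈ α.obj.D (inv k) := by
    rintro _ rfl x hx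
    simpa using α.obj.subset_range (inv g) hx
  have hf1 : f ∈ α.I (𝟙 a) x y := α.le_range (inv g) _ _ hf
  have hf2 : f ∈ α.I (inv (g ≫ inv g)) x y := by simpa using hf1
  rw [α.onMorph_onMorph (inv g) g hx hy (e (by simp) hx) (e (by simp) hy) hf hf2,
    IsIso.hom_inv_id]
  exact α.onMorph_id a (α.obj.subset_range _ hx) (α.obj.subset_range _ hy) hf1

theorem onMorph_onMorph_inv {a b : Γ} (g : a ⟶ b) {x y : C.Obj} {f : C.Hom x y}
    (hx : x ∈ α.obj.D g) (hy : y ∈ α.obj.D g) (hf : f ∈ α.I g x y) :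
    (α.semi g).onMorph ((α.semi (inv g)).onMorph ⟨x, y, f⟩) = ⟨x, y, f⟩ := by
  have h := α.onMorph_inv_onMorph (inv g) (x := x) (y := y) (f := f) (by simpa using hx)
    (by simpa using hy) (by simpa using hf)
  rwa [IsIso.inv_inv] at h

/-! ### The induced partial action on the algebra -/

theorem onAlg_act [C.IsSemicategory] {a b : Γ} (g : a ⟶ b) (w : α.onAlg.D (inv g)) :
    α.onAlg.act g w = (α.semi g).alg w.1 := by
  refine Finset.sum_congr rfl fun p _ => ?_
  exact congrArg _ (α.semi_hom g (w.2 p.1 p.2)).symm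

/-- The inclusion `α_h⁻¹(A_h ∩ A_{g⁻¹}) ⊆ A_{(g h)⁻¹}` for `A = a(C)`. -/
theorem alg_mem_of_mem_comp {a b c : Γ} (g : b ⟶ c) (h : a ⟶ b) {w : C.Alg}
    (hw : w ∈ subAlg (α.I (inv h))) (hw' : (α.semi h).alg w ∈ subAlg (α.I (inv g))) :
    w ∈ subAlg (α.I (inv (h ≫ g))) := by
  intro x y
  by_cases h0 : C.coeff x y w = 0
  · rw [h0]
    exact zero_mem _
  obtain ⟨hx, hy⟩ := α.mem_D_of_ne_zero _ (hw x y) h0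
  have h1 := hw' (α.obj.act h x) (α.obj.act h y)
  rw [(α.semi h).coeff_alg hw hx hy] at h1
  have h2 := α.hom_mem_comp (inv h) (inv g) (by simpa using α.hom_mem h (hw x y)) h1
  rw [← IsIso.inv_comp] at h2
  have h3 := α.onMorph_inv_onMorph h hx hy (hw x y)
  exact (congrArg (fun k : C.Morph => k.hom ∈ α.I (inv (h ≫ g)) k.src k.tgt) h3).mp h2

theorem alg_id (a : Γ) {w : C.Alg} (hw : w ∈ subAlg (α.I (𝟙 a))) :
    (α.semi (𝟙 a)).alg w = w := by
  have e : α.I (inv (𝟙 a)) = α.I (𝟙 a) := by rw [IsIso.inv_id]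
  induction hw using subAlg_induction with
  | h0 => simp
  | ha u hu v hv h1 h2 =>
    rw [← e] at hu hv
    rw [(α.semi (𝟙 a)).alg_add hu hv, h1, h2]
  | hs x y f hf =>
    rw [PartialSemifunctor.alg_single]
    by_cases h0 : f = 0
    · simp [h0]
    obtain ⟨hx, hy⟩ := α.mem_D_of_ne_zero _ hf h0
    exact single_congr (α.onMorph_id a hx hy hf)

theorem alg_alg {a b c : Γ} (g : b ⟶ c) (h : a ⟶ b) {w : C.Alg}
    (hw : w ∈ subAlg (α.I (inv h))) (hw' : w ∈ subAlg (α.I (inv (h ≫ g)))) :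
    (α.semi g).alg ((α.semi h).alg w) = (α.semi (h ≫ g)).alg w := by
  have key : w ∈ subAlg (fun x y => α.I (inv h) x y ⊓ α.I (inv (h ≫ g)) x y) :=
    fun x y => ⟨hw x y, hw' x y⟩
  clear hw hw'
  have m1 : ∀ {v : C.Alg}, v ∈ subAlg (fun x y => α.I (inv h) x y ⊓ α.I (inv (h ≫ g)) x y) →
      v ∈ subAlg (α.I (inv h)) := fun hv => subAlg_mono (fun _ _ => inf_le_left) hv
  have m2 : ∀ {v : C.Alg}, v ∈ subAlg (fun x y => α.I (inv h) x y ⊓ α.I (inv (h ≫ g)) x y) →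
      v ∈ subAlg (α.I (inv (h ≫ g))) := fun hv => subAlg_mono (fun _ _ => inf_le_right) hv
  have m3 : ∀ {v : C.Alg}, v ∈ subAlg (fun x y => α.I (inv h) x y ⊓ α.I (inv (h ≫ g)) x y) →
      (α.semi h).alg v ∈ subAlg (α.I (inv g)) := fun {v} hv =>
    sum_mem fun p _ => single_mem_subAlg
      (α.hom_mem_of_mem_comp g h (hv p.1 p.2).1 (hv p.1 p.2).2)
  induction key using subAlg_induction with
  | h0 => simp
  | ha u hu v hv h1 h2 =>
    rw [(α.semi h).alg_add (m1 hu) (m1 hv), (α.semi g).alg_add (m3 hu) (m3 hv),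
      (α.semi (h ≫ g)).alg_add (m2 hu) (m2 hv), h1, h2]
  | hs x y f hf =>
    rw [PartialSemifunctor.alg_single, PartialSemifunctor.alg_single,
      PartialSemifunctor.alg_single]
    by_cases h0 : f = 0
    · simp [h0]
    obtain ⟨hx, hy⟩ := α.mem_D_of_ne_zero _ hf.1 h0
    obtain ⟨hx', hy'⟩ := α.mem_D_of_ne_zero _ hf.2 h0
    exact single_congr (α.onMorph_onMorph g h hx hy hx' hy' hf.1 hf.2)

theorem alg_mem_subAlg {a b : Γ} (g : a ⟶ b) {w : C.Alg} (hw : w ∈ subAlg (α.I (inv g))) :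
    (α.semi g).alg w ∈ subAlg (α.I g) :=
  (α.semi g).alg_mem hw fun _ _ _ hf => α.hom_mem g hf

theorem alg_alg_inv {a b : Γ} (g : a ⟶ b) {w : C.Alg} (hw : w ∈ subAlg (α.I g)) :
    (α.semi g).alg ((α.semi (inv g)).alg w) = w := by
  have hw1 : w ∈ subAlg (α.I (inv (inv g))) := by rwa [IsIso.inv_inv]
  have hw2 : w ∈ subAlg (α.I (𝟙 b)) := subAlg_mono (α.le_range g) hw
  rw [α.alg_alg g (inv g) hw1 (by simpa using hw2), IsIso.inv_hom_id, α.alg_id b hw2]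

theorem onAlg_isPartialAction [C.IsSemicategory] : α.onAlg.IsPartialAction where
  ideal_left a s x hx := mul_mem_subAlg (I := fun _ _ => ⊤) (J := α.I (𝟙 a)) (K := α.I (𝟙 a))
    (fun f _ l hl => α.ideal_left a f l hl) (fun _ _ => trivial) hx
  ideal_right a x hx s := mul_mem_subAlg (I := α.I (𝟙 a)) (J := fun _ _ => ⊤) (K := α.I (𝟙 a))
    (fun f hf l _ => α.ideal_right a f hf l) hx (fun _ _ => trivial)
  le_range g := subAlg_mono (α.le_range g)
  ideal_range_left {a b} g s hs x hx := mul_mem_subAlg (I := α.I (𝟙 b)) (J := α.I g) (K := α.I g)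
    (fun f hf l hl => α.ideal_range_left g f hf l hl) hs hx
  ideal_range_right {a b} g x hx s hs := mul_mem_subAlg (I := α.I g) (J := α.I (𝟙 b)) (K := α.I g)
    (fun f hf l hl => α.ideal_range_right g f hf l hl) hx hs
  injective g x y h := by
    rw [onAlg_act, onAlg_act] at h
    exact Subtype.ext ((α.semi g).alg_inj x.2 y.2 h)
  range_eq g := by
    ext z
    constructor
    · rintro ⟨w, rfl⟩
      rw [onAlg_act]
      exact α.alg_mem_subAlg g w.2
    · intro hz
      have hz' : z ∈ subAlg (α.I (inv (inv g))) := by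
        rw [IsIso.inv_inv]
        exact hz
      refine ⟨⟨_, α.alg_mem_subAlg (inv g) hz'⟩, ?_⟩
      rw [onAlg_act]
      exact α.alg_alg_inv g hz
  map_add g x y := by
    rw [onAlg_act, onAlg_act, onAlg_act]
    exact (α.semi g).alg_add x.2 y.2
  map_mul g x y hxy := by
    rw [onAlg_act, onAlg_act, onAlg_act]
    exact (α.semi g).alg_mul x.2 y.2
  act_id a x := by
    rw [onAlg_act]
    refine α.alg_id a ?_
    obtain ⟨x, hx⟩ := x
    rwa [IsIso.inv_id] at hx
  mem_comp g h x hx := by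
    rw [onAlg_act] at hx
    exact α.alg_mem_of_mem_comp g h x.2 hx
  act_act g h x hg hgh := by
    simp only [onAlg_act]
    exact α.alg_alg g h x.2 hgh

variable {α}

theorem IsGlobal.onAlg [C.IsSemicategory] (hα : α.IsGlobal) : α.onAlg.IsGlobalAction where
  toIsPartialAction := α.onAlg_isPartialAction
  mem_iff g h x := by
    have key : x ∈ subAlg (α.I (inv (h ≫ g))) → x ∈ subAlg (α.I (inv h)) := by
      intro hx u v
      by_cases h0 : C.coeff u v x = 0
      · rw [h0]
        exact zero_mem _
      obtain ⟨hu, hv⟩ := α.mem_D_of_ne_zero _ (hx u v) h0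
      exact ((hα.mem_iff g h hu hv _).1 (hx u v)).1
    refine ⟨fun hx => ⟨key hx, ?_⟩, fun ⟨hx, hx'⟩ => ?_⟩
    · rw [onAlg_act]
      exact sum_mem fun p _ => single_mem_subAlg
        (α.hom_mem_of_mem_comp g h (key hx p.1 p.2) (hx p.1 p.2))
    · rw [onAlg_act] at hx'
      exact α.alg_mem_of_mem_comp g h hx hx'

end PartialAction

/-! ### Global actions -/

theorem PartialSetAction.IsGlobal.D_eq {Γ : Type u} [Groupoid.{u} Γ] {X : Type u}
    {β : PartialSetAction Γ X} (hβ : β.IsGlobal) {a b : Γ} (g : a ⟶ b) : β.D g = β.D (𝟙 b) := by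
  refine Set.Subset.antisymm (β.subset_range g) fun x hx => ?_
  simpa using ((hβ g (inv g) x).1.1 (by simpa using hx)).1

namespace PartialAction

variable {R : Type w} [CommRing R] {Γ : Type u} [Groupoid.{u} Γ] {C T : PreSemicat.{u} R}
  {α : PartialAction Γ C} {β : PartialAction Γ T}

theorem IsGlobal.I_eq (hβ : β.IsGlobal) {a b : Γ} (g : a ⟶ b) (u v : T.Obj) :
    β.I g u v = β.I (𝟙 b) u v := by
  refine le_antisymm (β.le_range g u v) fun f hf => ?_
  by_cases h0 : f = 0
  · rw [h0]
    exact zero_mem _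
  obtain ⟨hu, hv⟩ := β.mem_D_of_ne_zero _ hf h0
  obtain ⟨h, -⟩ := (hβ.mem_iff g (inv g) (by simpa using hu) (by simpa using hv) f).1
    (by simpa using hf)
  simpa using h

namespace Globalization

variable (G : α.Globalization β)

/-! ### The embedding of a partial action in its globalization -/

/-- The semifunctor `φ e` as a partially defined semifunctor from `C` to `T`. -/
noncomputable abbrev emb (e : Γ) : PartialSemifunctor C T where
  obj := G.ι
  carrier := Set.univ
  dom := α.I (𝟙 e)
  map := (Submodule.subtype _).comp (G.φ e)
  injOn := G.universal.injective.injOn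
  dom_eq_bot _ _ h := absurd ⟨trivial, trivial⟩ h
  map_injective _ _ := Subtype.val_injective.comp (G.φ_faithful e)
  comp_mem f _ l hl := α.ideal_left e f l hl
  map_comp _ _ _ f l h := G.φ_comp e f l h

theorem emb_hom (e : Γ) {x y : C.Obj} {f : C.Hom x y} (hf : f ∈ α.I (𝟙 e) x y) :
    (G.emb e).hom f = (G.φ e ⟨f, hf⟩).1 := (G.emb e).hom_of_mem hf

theorem onMorph_emb (e : Γ) {x y : C.Obj} {f : C.Hom x y} (hf : f ∈ α.I (𝟙 e) x y) :
    (G.emb e).onMorph ⟨x, y, f⟩ = ⟨_, _, (G.φ e ⟨f, hf⟩).1⟩ :=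
  congrArg (Morph.mk _ _) (G.emb_hom e hf)

theorem emb_mem (e : Γ) {x y : C.Obj} {f : C.Hom x y} (hf : f ∈ α.I (𝟙 e) x y) :
    (G.emb e).hom f ∈ β.I (𝟙 e) (G.ι x) (G.ι y) := by
  rw [G.emb_hom e hf]
  exact (G.φ e ⟨f, hf⟩).2

theorem emb_mem_inv {a b : Γ} (g : a ⟶ b) {x y : C.Obj} {f : C.Hom x y}
    (hf : f ∈ α.I (𝟙 a) x y) : (G.emb a).hom f ∈ β.I (inv g) (G.ι x) (G.ι y) := by
  rw [G.global.I_eq (inv g)]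
  exact G.emb_mem a hf

theorem onMorph_emb_semi {a b : Γ} (g : a ⟶ b) {x y : C.Obj} {f : C.Hom x y}
    (hx : x ∈ α.obj.D (inv g)) (hy : y ∈ α.obj.D (inv g)) (hf : f ∈ α.I (inv g) x y) :
    (β.semi g).onMorph ((G.emb a).onMorph ⟨x, y, f⟩) =
      (G.emb b).onMorph ((α.semi g).onMorph ⟨x, y, f⟩) := by
  obtain ⟨h, he⟩ := G.map_φ g hx hy ⟨f, hf⟩
  rw [G.onMorph_emb a (α.le_range _ _ _ hf), β.onMorph_mk g h, α.onMorph_mk g hf,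
    G.onMorph_emb b (α.le_range g _ _ (α.map g ⟨f, hf⟩).2)]
  exact he

/-- For a global action all the sets `D g` with `r(g) = e` coincide, so `ι x` lies in each of them. -/
theorem ι_mem (e : Γ) {x : C.Obj} (hx : x ∈ α.obj.D (𝟙 e)) {c : Γ} (g : c ⟶ e) :
    G.ι x ∈ β.obj.D g := by
  rw [PartialSetAction.IsGlobal.D_eq G.global.obj g]
  simpa using ((G.universal.mem_iff (𝟙 e) x).1 (by simpa using hx)).1

/-- A nonzero morphism in the image of `φ_{r(g)}` and in the `β^g`-translate of the image of
`φ_{d(g)}` comes from `I^g`. -/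
theorem mem_of_onMorph_eq {a b : Γ} (g : a ⟶ b) {x y x' y' : C.Obj} {f : C.Hom x y}
    {f' : C.Hom x' y'} (hf : f ∈ α.I (𝟙 b) x y) (hf' : f' ∈ α.I (𝟙 a) x' y') (h0 : f' ≠ 0)
    (h : (G.emb b).onMorph ⟨x, y, f⟩ = (β.semi g).onMorph ((G.emb a).onMorph ⟨x', y', f'⟩)) :
    x' ∈ α.obj.D (inv g) ∧ α.obj.act g x' = x ∧ f ∈ α.I g x y := by
  obtain ⟨hx', hy'⟩ := α.mem_D_of_ne_zero _ hf' h0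
  have hgx : G.ι x = β.obj.act g (G.ι x') := congrArg Morph.src h
  have hgy : G.ι y = β.obj.act g (G.ι y') := congrArg Morph.tgt h
  have hxd : x' ∈ α.obj.D (inv g) :=
    (G.universal.mem_iff g x').2 ⟨G.ι_mem a hx' _, x, hgx⟩
  have hyd : y' ∈ α.obj.D (inv g) :=
    (G.universal.mem_iff g y').2 ⟨G.ι_mem a hy' _, y, hgy⟩
  have ex : α.obj.act g x' = x :=
    G.universal.injective ((G.universal.map_act g x' hxd).trans hgx.symm)
  have ey : α.obj.act g y' = y :=
    G.universal.injective ((G.universal.map_act g y' hyd).trans hgy.symm)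
  have ex' : x' = α.obj.act (inv g) x := by rw [← ex, α.obj.act_inv_act g hxd]
  have ey' : y' = α.obj.act (inv g) y := by rw [← ey, α.obj.act_inv_act g hyd]
  have hx : x ∈ α.obj.D g := ex ▸ α.obj.act_mem g hxd
  have hy : y ∈ α.obj.D g := ey ▸ α.obj.act_mem g hyd
  refine ⟨hxd, ex, ?_⟩
  clear ex ey
  subst ex' ey'
  have hm := G.emb_mem_inv g hf'
  rw [G.emb_hom a hf'] at hm
  rw [G.onMorph_emb b hf, G.onMorph_emb a hf', β.onMorph_mk g hm] at h
  obtain ⟨f₁, hf₁, he⟩ := (G.φ_inter g hx hy _).2 ⟨⟨⟨f, hf⟩, rfl⟩, ⟨f', hf'⟩, hm, h⟩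
  have := congrArg Subtype.val (G.φ_faithful b (Subtype.ext he))
  rwa [← show f₁.1 = f from this]

/-- On `I^g` the image of `φ_{r(g)}` lies in the `β^g`-translate of the image of `φ_{d(g)}`. -/
theorem exists_onMorph_eq {a b : Γ} (g : a ⟶ b) {x y : C.Obj} {f : C.Hom x y}
    (hx : x ∈ α.obj.D g) (hy : y ∈ α.obj.D g) (hf : f ∈ α.I g x y) :
    ∃ f' ∈ α.I (𝟙 a) (α.obj.act (inv g) x) (α.obj.act (inv g) y),
      (G.emb b).onMorph ⟨x, y, f⟩ = (β.semi g).onMorph ((G.emb a).onMorph ⟨_, _, f'⟩) := by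
  have hf1 := α.le_range g _ _ hf
  obtain ⟨-, ⟨f', hf'⟩, hm, h⟩ := (G.φ_inter g hx hy _).1 ⟨⟨f, hf1⟩, hf, rfl⟩
  exact ⟨f', hf', by rw [G.onMorph_emb b hf1, G.onMorph_emb a hf', β.onMorph_mk g hm, h]⟩

/-- The image of `φ e` is a left ideal: a nonzero composite is again an image, and its source is
unchanged because `ι` is injective. -/
theorem exists_comp_left (e : Γ) {x y : C.Obj} {v : T.Obj} {f : C.Hom x y}
    (hf : f ∈ α.I (𝟙 e) x y) {k : T.Hom (G.ι y) v} (hk : k ∈ β.I (𝟙 e) (G.ι y) v)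
    (h0 : T.comp k ((G.emb e).hom f) ≠ 0) :
    ∃ y', G.ι y' = v ∧ ∃ f' ∈ α.I (𝟙 e) x y',
      (⟨_, _, T.comp k ((G.emb e).hom f)⟩ : T.Morph) = (G.emb e).onMorph ⟨x, y', f'⟩ := by
  rw [G.emb_hom e hf] at h0 ⊢
  obtain h | ⟨x', y', ⟨f', hf'⟩, h⟩ := G.φ_ideal_left e ⟨f, hf⟩ k hk
  · exact absurd h h0
  · obtain rfl : x = x' := G.universal.injective (congrArg Morph.src h)
    exact ⟨y', (congrArg Morph.tgt h).symm, f', hf', by rw [G.onMorph_emb e hf']; exact h⟩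

/-- The image of `φ e` is a right ideal: a nonzero composite is again an image, and its target is
unchanged because `ι` is injective. -/
theorem exists_comp_right (e : Γ) {x y : C.Obj} {v : T.Obj} {f : C.Hom x y}
    (hf : f ∈ α.I (𝟙 e) x y) {k : T.Hom v (G.ι x)} (hk : k ∈ β.I (𝟙 e) v (G.ι x))
    (h0 : T.comp ((G.emb e).hom f) k ≠ 0) :
    ∃ x', G.ι x' = v ∧ ∃ f' ∈ α.I (𝟙 e) x' y,
      (⟨_, _, T.comp ((G.emb e).hom f) k⟩ : T.Morph) = (G.emb e).onMorph ⟨x', y, f'⟩ := by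
  rw [G.emb_hom e hf] at h0 ⊢
  obtain h | ⟨x', y', ⟨f', hf'⟩, h⟩ := G.φ_ideal_right e ⟨f, hf⟩ k hk
  · exact absurd h h0
  · obtain rfl : y = y' := G.universal.injective (congrArg Morph.tgt h)
    exact ⟨x', (congrArg Morph.src h).symm, f', hf', by rw [G.onMorph_emb e hf']; exact h⟩

/-- `J^g` is generated, as an additive group, by the translates of the images of the `φ e`. -/
theorem I_induction {a b : Γ} (g : a ⟶ b) {u v : T.Obj} {P : T.Hom u v → Prop} (h0 : P 0)
    (hadd : ∀ k l, P k → P l → P (k + l))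
    (hgen : ∀ (k : T.Hom u v) (c : Γ) (h : c ⟶ b) (x y : C.Obj), ∀ f ∈ α.I (𝟙 c) x y,
      (⟨u, v, k⟩ : T.Morph) = (β.semi h).onMorph ((G.emb c).onMorph ⟨x, y, f⟩) → P k)
    {k : T.Hom u v} (hk : k ∈ β.I g u v) : P k := by
  rw [G.eq_sum g u v] at hk
  induction hk using Submodule.closure_induction with
  | zero => exact h0
  | add k l _ _ h1 h2 => exact hadd k l h1 h2
  | smul_mem r k hk =>
    obtain ⟨c, h, x, y, ⟨f, hf⟩, hm, he⟩ := hk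
    refine hgen _ c h x y (r • f) (Submodule.smul_mem _ r hf) ?_
    have hm' := G.emb_mem_inv h hf
    simp only [PartialSemifunctor.onMorph, (G.emb c).hom_smul r hf, (β.semi h).hom_smul r hm']
    rw [← β.onMorph_mk h hm, ← G.onMorph_emb c hf] at he
    cases he
    rfl

/-! ### The globalization of the partial action on the algebra -/

theorem alg_emb_mem (e : Γ) {w : C.Alg} (hw : w ∈ subAlg (α.I (𝟙 e))) :
    (G.emb e).alg w ∈ subAlg (β.I (𝟙 e)) :=
  (G.emb e).alg_mem hw fun _ _ _ hf => G.emb_mem e hf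

theorem alg_emb_mem_inv {a b : Γ} (g : a ⟶ b) {w : C.Alg} (hw : w ∈ subAlg (α.I (𝟙 a))) :
    (G.emb a).alg w ∈ subAlg (β.I (inv g)) :=
  (G.emb a).alg_mem hw fun _ _ _ hf => G.emb_mem_inv g hf

theorem alg_emb_semi {a b : Γ} (g : a ⟶ b) {w : C.Alg} (hw : w ∈ subAlg (α.I (inv g))) :
    (β.semi g).alg ((G.emb a).alg w) = (G.emb b).alg ((α.semi g).alg w) := by
  have m1 : ∀ {v}, v ∈ subAlg (α.I (inv g)) → v ∈ subAlg (α.I (𝟙 a)) :=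
    fun hv => subAlg_mono (α.le_range (inv g)) hv
  have m2 : ∀ {v}, v ∈ subAlg (α.I g) → v ∈ subAlg (α.I (𝟙 b)) :=
    fun hv => subAlg_mono (α.le_range g) hv
  induction hw using subAlg_induction with
  | h0 => simp
  | ha u hu v hv h1 h2 =>
    rw [(G.emb a).alg_add (m1 hu) (m1 hv), (α.semi g).alg_add hu hv,
      (β.semi g).alg_add (G.alg_emb_mem_inv g (m1 hu)) (G.alg_emb_mem_inv g (m1 hv)),
      (G.emb b).alg_add (m2 (α.alg_mem_subAlg g hu)) (m2 (α.alg_mem_subAlg g hv)), h1, h2]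
  | hs x y f hf =>
    by_cases h0 : f = 0
    · simp [h0]
    obtain ⟨hx, hy⟩ := α.mem_D_of_ne_zero _ hf h0
    simp only [PartialSemifunctor.alg_single]
    exact single_congr (G.onMorph_emb_semi g hx hy hf)

theorem exists_alg_eq_mul_left (e : Γ) {w : C.Alg} (hw : w ∈ subAlg (α.I (𝟙 e))) {s : T.Alg}
    (hs : s ∈ subAlg (β.I (𝟙 e))) :
    ∃ v ∈ subAlg (α.I (𝟙 e)), (G.emb e).alg v = s * (G.emb e).alg w := by
  induction hw using subAlg_induction with
  | h0 => exact ⟨0, zero_mem _, by simp⟩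
  | ha u hu v hv h1 h2 =>
    obtain ⟨p, hp, h1⟩ := h1
    obtain ⟨q, hq, h2⟩ := h2
    exact ⟨p + q, add_mem hp hq, by
      rw [(G.emb e).alg_add hp hq, (G.emb e).alg_add hu hv, h1, h2, mul_add]⟩
  | hs x y f hf =>
    induction hs using subAlg_induction with
    | h0 => exact ⟨0, zero_mem _, by simp⟩
    | ha u hu v hv h1 h2 =>
      obtain ⟨p, hp, h1⟩ := h1
      obtain ⟨q, hq, h2⟩ := h2
      exact ⟨p + q, add_mem hp hq, by rw [(G.emb e).alg_add hp hq, h1, h2, add_mul]⟩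
    | hs y' v k hk =>
      rw [PartialSemifunctor.alg_single]
      by_cases hy : G.ι y = y'
      · subst hy
        rw [single_mul_single_eq]
        by_cases h0 : T.comp k ((G.emb e).hom f) = 0
        · exact ⟨0, zero_mem _, by simp [h0]⟩
        obtain ⟨z, -, f', hf', h⟩ := G.exists_comp_left e hf hk h0
        exact ⟨_, single_mem_subAlg hf', by
          rw [PartialSemifunctor.alg_single]; exact (single_congr h).symm⟩
      · exact ⟨0, zero_mem _, by rw [single_mul_single_ne T hy, PartialSemifunctor.alg_zero]⟩

theorem exists_alg_eq_mul_right (e : Γ) {w : C.Alg} (hw : w ∈ subAlg (α.I (𝟙 e))) {s : T.Alg}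
    (hs : s ∈ subAlg (β.I (𝟙 e))) :
    ∃ v ∈ subAlg (α.I (𝟙 e)), (G.emb e).alg v = (G.emb e).alg w * s := by
  induction hw using subAlg_induction with
  | h0 => exact ⟨0, zero_mem _, by simp⟩
  | ha u hu v hv h1 h2 =>
    obtain ⟨p, hp, h1⟩ := h1
    obtain ⟨q, hq, h2⟩ := h2
    exact ⟨p + q, add_mem hp hq, by
      rw [(G.emb e).alg_add hp hq, (G.emb e).alg_add hu hv, h1, h2, add_mul]⟩
  | hs x y f hf =>
    induction hs using subAlg_induction with
    | h0 => exact ⟨0, zero_mem _, by simp⟩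
    | ha u hu v hv h1 h2 =>
      obtain ⟨p, hp, h1⟩ := h1
      obtain ⟨q, hq, h2⟩ := h2
      exact ⟨p + q, add_mem hp hq, by rw [(G.emb e).alg_add hp hq, h1, h2, mul_add]⟩
    | hs v x' k hk =>
      rw [PartialSemifunctor.alg_single]
      by_cases hx : x' = G.ι x
      · subst hx
        rw [single_mul_single_eq]
        by_cases h0 : T.comp ((G.emb e).hom f) k = 0
        · exact ⟨0, zero_mem _, by simp [h0]⟩
        obtain ⟨z, -, f', hf', h⟩ := G.exists_comp_right e hf hk h0
        exact ⟨_, single_mem_subAlg hf', by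
          rw [PartialSemifunctor.alg_single]; exact (single_congr h).symm⟩
      · exact ⟨0, zero_mem _, by rw [single_mul_single_ne T hx, PartialSemifunctor.alg_zero]⟩

/-- `ψ(A_g) ⊆ β_g(ψ(A_{d(g)}))` for `A = a(C)`. -/
theorem exists_alg_semi_eq {a b : Γ} (g : a ⟶ b) {w : C.Alg} (hw : w ∈ subAlg (α.I g)) :
    ∃ v ∈ subAlg (α.I (𝟙 a)), (β.semi g).alg ((G.emb a).alg v) = (G.emb b).alg w := by
  have m : ∀ {v}, v ∈ subAlg (α.I g) → v ∈ subAlg (α.I (𝟙 b)) :=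
    fun hv => subAlg_mono (α.le_range g) hv
  induction hw using subAlg_induction with
  | h0 => exact ⟨0, zero_mem _, by simp⟩
  | ha u hu v hv h1 h2 =>
    obtain ⟨p, hp, h1⟩ := h1
    obtain ⟨q, hq, h2⟩ := h2
    exact ⟨p + q, add_mem hp hq, by
      rw [(G.emb a).alg_add hp hq, (G.emb b).alg_add (m hu) (m hv),
        (β.semi g).alg_add (G.alg_emb_mem_inv g hp) (G.alg_emb_mem_inv g hq), h1, h2]⟩
  | hs x y f hf =>
    by_cases h0 : f = 0
    · exact ⟨0, zero_mem _, by simp [h0]⟩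
    obtain ⟨hx, hy⟩ := α.mem_D_of_ne_zero _ hf h0
    obtain ⟨f', hf', h⟩ := G.exists_onMorph_eq g hx hy hf
    refine ⟨_, single_mem_subAlg hf', ?_⟩
    simp only [PartialSemifunctor.alg_single]
    exact (single_congr h).symm

/-- `ψ(A_{r(g)}) ∩ β_g(ψ(A_{d(g)})) ⊆ ψ(A_g)` for `A = a(C)`: each nonzero component of the left side
is a morphism to which `mem_of_onMorph_eq` applies. -/
theorem mem_of_alg_eq {a b : Γ} (g : a ⟶ b) {w v : C.Alg} (hw : w ∈ subAlg (α.I (𝟙 b)))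
    (hv : v ∈ subAlg (α.I (𝟙 a))) (h : (G.emb b).alg w = (β.semi g).alg ((G.emb a).alg v)) :
    w ∈ subAlg (α.I g) := by
  intro x y
  by_cases h0 : C.coeff x y w = 0
  · rw [h0]
    exact zero_mem _
  have hm := G.alg_emb_mem_inv g hv
  have h1 : T.coeff (G.ι x) (G.ι y) ((β.semi g).alg ((G.emb a).alg v)) =
      (G.emb b).hom (C.coeff x y w) := by
    rw [← h]
    exact (G.emb b).coeff_alg hw trivial trivial
  have hne : (G.emb b).hom (C.coeff x y w) ≠ 0 := fun h' =>
    h0 ((G.emb b).hom_inj (hw x y) (zero_mem _) (by rw [h', PartialSemifunctor.hom_zero]))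
  obtain ⟨u, hu, u', hu', hgu, hgu'⟩ :=
    (β.semi g).exists_of_coeff_alg_ne_zero hm (by rwa [h1])
  have h2 := (β.semi g).coeff_alg hm hu hu'
  have hne2 : T.coeff u u' ((G.emb a).alg v) ≠ 0 := by
    intro h'
    rw [h', PartialSemifunctor.hom_zero] at h2
    have aux : ∀ p q, p = G.ι x → q = G.ι y →
        T.coeff p q ((β.semi g).alg ((G.emb a).alg v)) ≠ 0 := by
      rintro _ _ rfl rfl
      rwa [h1]
    exact aux _ _ hgu hgu' h2
  obtain ⟨x', -, y', -, rfl, rfl⟩ := (G.emb a).exists_of_coeff_alg_ne_zero hv hne2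
  have h3 := (G.emb a).coeff_alg hv (x := x') (y := y') trivial trivial
  rw [h3] at h2 hne2
  refine (G.mem_of_onMorph_eq g (hw x y) (hv x' y') (fun h' => hne2 (by simp [h'])) ?_).2.2
  simp only [PartialSemifunctor.onMorph]
  rw [← h1, ← h2, ← hgu, ← hgu']

theorem onAlg_isGlobalization (G : α.Globalization β) [C.IsSemicategory] [T.IsSemicategory] :
    α.onAlg.IsGlobalization β.onAlg where
  partialAction := α.onAlg_isPartialAction
  global := G.global.onAlg
  exists_mono := by
    refine ⟨fun e => AddMonoidHom.mk' (fun w => ⟨(G.emb e).alg w.1, G.alg_emb_mem e w.2⟩)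
      fun w v => Subtype.ext ((G.emb e).alg_add w.2 v.2), ?_, ?_, ?_, ?_, ?_, ?_⟩
    · intro e w v h
      exact Subtype.ext ((G.emb e).alg_inj w.2 v.2 (congrArg Subtype.val h))
    · intro e w v _
      exact (G.emb e).alg_mul w.2 v.2
    · intro e w s hs
      obtain ⟨p, hp, h1⟩ := G.exists_alg_eq_mul_left e w.2 hs
      obtain ⟨q, hq, h2⟩ := G.exists_alg_eq_mul_right e w.2 hs
      exact ⟨⟨⟨p, hp⟩, h1⟩, ⟨⟨q, hq⟩, h2⟩⟩
    · intro a b g z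
      constructor
      · rintro ⟨w, hw, rfl⟩
        obtain ⟨v, hv, h⟩ := G.exists_alg_semi_eq g hw
        refine ⟨⟨w, rfl⟩, ⟨v, hv⟩, G.alg_emb_mem_inv g hv, ?_⟩
        rw [onAlg_act]
        exact h
      · rintro ⟨⟨w, hw⟩, v, hv, h⟩
        rw [onAlg_act] at h
        exact ⟨w, G.mem_of_alg_eq g w.2 v.2 (hw.trans h.symm), hw⟩
    · intro a b g w
      have hw := subAlg_mono (α.le_range (inv g)) w.2
      refine ⟨hw, G.alg_emb_mem_inv g hw, ?_, ?_⟩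
      · rw [onAlg_act]
        exact subAlg_mono (α.le_range g) (α.alg_mem_subAlg g w.2)
      · rw [onAlg_act]
        exact (G.alg_emb_semi g w.2).trans (congrArg (G.emb b).alg (α.onAlg_act g w).symm)
    · intro a b g
      refine le_antisymm (fun z hz => ?_) ((AddSubgroup.closure_le _).2 ?_)
      · change z ∈ subAlg (β.I g) at hz
        induction hz using subAlg_induction with
        | h0 => exact zero_mem _
        | ha u _ v _ h1 h2 => exact add_mem h1 h2
        | hs u v k hk =>
          refine G.I_induction g (P := fun k => T.single u v k ∈ AddSubgroup.closure _) ?_ ?_ ?_ hk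
          · rw [map_zero]
            exact zero_mem _
          · intro k l h1 h2
            rw [map_add]
            exact add_mem h1 h2
          · intro k c h x y f hf he
            refine AddSubgroup.subset_closure ⟨c, h, ⟨_, single_mem_subAlg hf⟩,
              G.alg_emb_mem_inv h (single_mem_subAlg hf), ?_⟩
            rw [onAlg_act]
            refine (single_congr he).trans ?_
            change _ = (β.semi h).alg ((G.emb c).alg (C.single x y f))
            simp only [PartialSemifunctor.alg_single]
            rfl
      · rintro z ⟨c, h, w, hw, rfl⟩
        rw [onAlg_act]
        intro u v
        rw [G.global.I_eq g, ← G.global.I_eq h]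
        exact β.alg_mem_subAlg h hw u v

end Globalization

end PartialAction

/-! ### Morita equivalence with a one-sided corner -/

namespace UnitalModule

variable {A : Type u} [NonUnitalRing A]

theorem mul_smul (X : UnitalModule A) (a b : A) (x : X.carrier) :
    X.smul (a * b) x = X.smul a (X.smul b x) := by
  rw [map_mul]
  rfl

theorem add_smul (X : UnitalModule A) (a b : A) (x : X.carrier) :
    X.smul (a + b) x = X.smul a x + X.smul b x := by
  rw [map_add]
  rfl

theorem hom_ext {X Y : UnitalModule A} {f g : X ⟶ Y} (h : ∀ x, f.toFun x = g.toFun x) : f = g :=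
  Hom.ext (AddMonoidHom.ext h)

/-- A bijective homomorphism is an isomorphism. -/
noncomputable def isoOfBijective {X Y : UnitalModule A} (f : X ⟶ Y)
    (hf : Function.Bijective f.toFun) : X ≅ Y where
  hom := f
  inv := ⟨(AddEquiv.ofBijective f.toFun hf).symm.toAddMonoidHom, fun a y => by
    apply hf.injective
    have e : ∀ z, f.toFun ((AddEquiv.ofBijective f.toFun hf).symm z) = z :=
      (AddEquiv.ofBijective f.toFun hf).apply_symm_apply
    rw [f.map_smul]
    exact (e _).trans (congrArg _ (e y).symm)⟩
  hom_inv_id := hom_ext (AddEquiv.ofBijective f.toFun hf).symm_apply_apply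
  inv_hom_id := hom_ext (AddEquiv.ofBijective f.toFun hf).apply_symm_apply

end UnitalModule

/-- A ring `A` embedded in a ring `B` together with a right ideal `M` and a left ideal `N` of `B`
such that `M N ⊆ A ⊆ M ∩ N` and `N M = B`, and a net of elements of `A` which are eventually left
units for each element of `M`.  (For an idempotent `e` of a unital ring `B` with `B e B = B` this
holds with `A = e B e`, `M = e B`, `N = B e` and the constant net `e`.) -/
structure CornerContext (A B : Type u) [NonUnitalRing A] [NonUnitalRing B] where
  θ : A →ₙ+* B
  M : AddSubgroup B
  N : AddSubgroup B
  injective : Function.Injective θ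
  mul_mem_M : ∀ m ∈ M, ∀ b, m * b ∈ M
  mul_mem_N : ∀ b, ∀ n ∈ N, b * n ∈ N
  mem_M : ∀ a, θ a ∈ M
  mem_N : ∀ a, θ a ∈ N
  mul_mem_range : ∀ m ∈ M, ∀ n ∈ N, ∃ a, θ a = m * n
  closure_eq_top : AddSubgroup.closure {b | ∃ n ∈ N, ∃ m ∈ M, n * m = b} = ⊤
  index : Type u
  filter : Filter index
  neBot : filter.NeBot
  unit : index → A
  eventually_unit_mul : ∀ m ∈ M, ∀ᶠ i in filter, θ (unit i) * m = m

namespace CornerContext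

variable {A B : Type u} [NonUnitalRing A] [NonUnitalRing B] (K : CornerContext A B)

attribute [instance] CornerContext.neBot

/-- The product of an element of `M` and an element of `N`, as an element of `A`. -/
noncomputable def pair (m : K.M) (n : K.N) : A := (K.mul_mem_range m m.2 n n.2).choose

theorem θ_pair (m : K.M) (n : K.N) : K.θ (K.pair m n) = m * n :=
  (K.mul_mem_range m m.2 n n.2).choose_spec

theorem pair_eq {m : K.M} {n : K.N} {a : A} (h : K.θ a = m * n) : K.pair m n = a :=
  K.injective ((K.θ_pair m n).trans h.symm)

theorem pair_add_left (m m' : K.M) (n : K.N) :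
    K.pair (m + m') n = K.pair m n + K.pair m' n :=
  K.pair_eq (by rw [map_add, θ_pair, θ_pair, AddSubgroup.coe_add, add_mul])

theorem pair_mul (m : K.M) (n : K.N) (a : A) :
    K.pair m n * a = K.pair m ⟨n * K.θ a, K.mul_mem_N n _ (K.mem_N a)⟩ :=
  (K.pair_eq (by rw [map_mul, θ_pair, mul_assoc])).symm

theorem pair_mul_left (m : K.M) (b : B) (n : K.N) :
    K.pair ⟨m * b, K.mul_mem_M m m.2 b⟩ n = K.pair m ⟨b * n, K.mul_mem_N b n n.2⟩ :=
  K.pair_eq (by rw [θ_pair, mul_assoc])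

theorem eventually_unit_mul' (a : A) : ∀ᶠ i in K.filter, K.unit i * a = a :=
  (K.eventually_unit_mul _ (K.mem_M a)).mono fun i hi => K.injective (by rw [map_mul, hi])

theorem isIdempotentRing_left (K : CornerContext A B) : IsIdempotentRing A := by
  refine (AddSubgroup.eq_top_iff' _).2 fun a => ?_
  obtain ⟨i, hi⟩ := (K.eventually_unit_mul' a).exists
  exact AddSubgroup.subset_closure ⟨_, _, hi⟩

theorem isIdempotentRing_right (K : CornerContext A B) : IsIdempotentRing B := by
  refine eq_top_iff.2 (K.closure_eq_top.ge.trans (AddSubgroup.closure_mono ?_))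
  rintro b ⟨n, -, m, -, h⟩
  exact ⟨n, m, h⟩

/-! ### The functor `X ↦ M X` -/

/-- The additive subgroup `M X` of a `B`-module `X`. -/
def sub (X : UnitalModule B) : AddSubgroup X.carrier :=
  AddSubgroup.closure {y | ∃ m ∈ K.M, ∃ x, X.smul m x = y}

theorem smul_mem_sub (X : UnitalModule B) {m : B} (hm : m ∈ K.M) (x : X.carrier) :
    X.smul m x ∈ K.sub X := AddSubgroup.subset_closure ⟨m, hm, x, rfl⟩

theorem eventually_unit_smul_sub (X : UnitalModule B) {y : X.carrier} (hy : y ∈ K.sub X) :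
    ∀ᶠ i in K.filter, X.smul (K.θ (K.unit i)) y = y := by
  induction hy using AddSubgroup.closure_induction with
  | mem y h =>
    obtain ⟨m, hm, x, rfl⟩ := h
    filter_upwards [K.eventually_unit_mul m hm] with i hi
    rw [← X.mul_smul, hi]
  | zero => exact Filter.Eventually.of_forall fun i => map_zero _
  | add y y' _ _ h h' =>
    filter_upwards [h, h'] with i hi hi'
    rw [map_add, hi, hi']
  | neg y _ h =>
    filter_upwards [h] with i hi
    rw [map_neg, hi]

/-- `X = N M X`, since `B = N M`. -/
theorem closure_smul_sub (X : UnitalModule B) :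
    AddSubgroup.closure {x | ∃ n ∈ K.N, ∃ y ∈ K.sub X, X.smul n y = x} = ⊤ := by
  refine eq_top_iff.2 (X.unital.ge.trans ((AddSubgroup.closure_le _).2 ?_))
  rintro _ ⟨b, x, rfl⟩
  have hb : b ∈ AddSubgroup.closure {b | ∃ n ∈ K.N, ∃ m ∈ K.M, n * m = b} := by
    rw [K.closure_eq_top]
    trivial
  induction hb using AddSubgroup.closure_induction with
  | mem b h =>
    obtain ⟨n, hn, m, hm, rfl⟩ := h
    rw [X.mul_smul]
    exact AddSubgroup.subset_closure ⟨n, hn, _, K.smul_mem_sub X hm x, rfl⟩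
  | zero =>
    rw [map_zero]
    exact zero_mem _
  | add b b' _ _ h h' =>
    rw [X.add_smul]
    exact add_mem h h'
  | neg b _ h =>
    rw [map_neg]
    exact neg_mem h

/-- Elements of a torsion-free module are determined by their multiples by elements of `M`, since
`B = N M`. -/
theorem eq_of_smul_eq (X : UnitalModule B) {x x' : X.carrier}
    (h : ∀ m ∈ K.M, X.smul m x = X.smul m x') : x = x' := by
  refine sub_eq_zero.1 (X.torsionFree _ fun b => ?_)
  have hb : b ∈ AddSubgroup.closure {b | ∃ n ∈ K.N, ∃ m ∈ K.M, n * m = b} := by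
    rw [K.closure_eq_top]
    trivial
  induction hb using AddSubgroup.closure_induction with
  | mem b hb =>
    obtain ⟨n, hn, m, hm, rfl⟩ := hb
    rw [X.mul_smul, map_sub (X.smul m), h m hm, sub_self, map_zero]
  | zero =>
    rw [map_zero]
    rfl
  | add b b' _ _ h h' => rw [X.add_smul, h, h', add_zero]
  | neg b _ h =>
    rw [map_neg]
    exact neg_eq_zero.2 h

/-- The `A`-module `M X`. -/
def restrict (X : UnitalModule B) : UnitalModule A where
  carrier := K.sub X
  smul :=
    { toFun a := AddMonoidHom.mk' (fun y => ⟨X.smul (K.θ a) y.1, K.smul_mem_sub X (K.mem_M a) _⟩)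
        fun y y' => Subtype.ext (map_add (X.smul (K.θ a)) y.1 y'.1)
      map_mul' a b := AddMonoidHom.ext fun y => Subtype.ext <| by
        change X.smul (K.θ (a * b)) y.1 = X.smul (K.θ a) (X.smul (K.θ b) y.1)
        rw [map_mul, X.mul_smul]
      map_zero' := AddMonoidHom.ext fun y => Subtype.ext <| by
        change X.smul (K.θ 0) y.1 = 0
        rw [map_zero, map_zero]
        rfl
      map_add' a b := AddMonoidHom.ext fun y => Subtype.ext <| by
        change X.smul (K.θ (a + b)) y.1 = X.smul (K.θ a) y.1 + X.smul (K.θ b) y.1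
        rw [map_add, X.add_smul] }
  unital := by
    refine (AddSubgroup.eq_top_iff' _).2 fun y => ?_
    obtain ⟨i, hi⟩ := (K.eventually_unit_smul_sub X y.2).exists
    exact AddSubgroup.subset_closure ⟨K.unit i, y, Subtype.ext hi⟩
  torsionFree y h := by
    obtain ⟨i, hi⟩ := (K.eventually_unit_smul_sub X y.2).exists
    exact Subtype.ext (hi.symm.trans (congrArg Subtype.val (h (K.unit i))))

theorem map_mem_sub {X X' : UnitalModule B} (f : X ⟶ X') {y : X.carrier} (hy : y ∈ K.sub X) :
    f.toFun y ∈ K.sub X' := by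
  induction hy using AddSubgroup.closure_induction with
  | mem y h =>
    obtain ⟨m, hm, x, rfl⟩ := h
    rw [f.map_smul]
    exact K.smul_mem_sub X' hm _
  | zero =>
    rw [map_zero]
    exact zero_mem _
  | add y y' _ _ h h' =>
    rw [map_add]
    exact add_mem h h'
  | neg y _ h =>
    rw [map_neg]
    exact neg_mem h

/-- The functor `X ↦ M X` from `B`-modules to `A`-modules. -/
def functor : UnitalModule B ⥤ UnitalModule A where
  obj := K.restrict
  map f := ⟨AddMonoidHom.mk' (fun y => ⟨f.toFun y.1, K.map_mem_sub f y.2⟩)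
    fun y y' => Subtype.ext (map_add f.toFun y.1 y'.1),
    fun a y => Subtype.ext (f.map_smul (K.θ a) y.1)⟩
  map_id _ := rfl
  map_comp _ _ := rfl

instance : K.functor.Faithful where
  map_injective {X X'} f g h := by
    refine UnitalModule.hom_ext fun x => ?_
    have hx : x ∈ AddSubgroup.closure {x | ∃ n ∈ K.N, ∃ y ∈ K.sub X, X.smul n y = x} := by
      rw [K.closure_smul_sub]
      trivial
    have key : ∀ y ∈ K.sub X, f.toFun y = g.toFun y := fun y hy =>
      congrArg (fun k : K.restrict X ⟶ K.restrict X' => (k.toFun ⟨y, hy⟩).1) h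
    induction hx using AddSubgroup.closure_induction with
    | mem x hx =>
      obtain ⟨n, -, y, hy, rfl⟩ := hx
      rw [f.map_smul, g.map_smul, key y hy]
    | zero => rw [map_zero, map_zero]
    | add x x' _ _ h h' => rw [map_add, map_add, h, h']
    | neg x _ h => rw [map_neg, map_neg, h]

/-- An `A`-linear map `M X → M X'` extends to a map `X → X'`, which sends `x` to the only `x'` with
`m x' = f (m x)` for all `m` in `M`. -/
theorem exists_extension {X X' : UnitalModule B} (f : K.sub X →+ X'.carrier)
    (hf : ∀ a (y : K.sub X),
      f ⟨X.smul (K.θ a) y, K.smul_mem_sub X (K.mem_M a) y⟩ = X'.smul (K.θ a) (f y))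
    (x : X.carrier) : ∃ x' : X'.carrier, ∀ (m : B) (hm : m ∈ K.M),
      X'.smul m x' = f ⟨X.smul m x, K.smul_mem_sub X hm x⟩ := by
  have hx : x ∈ AddSubgroup.closure {x | ∃ n ∈ K.N, ∃ y ∈ K.sub X, X.smul n y = x} := by
    rw [K.closure_smul_sub]
    trivial
  induction hx using AddSubgroup.closure_induction with
  | mem x hx =>
    obtain ⟨n, hn, y, hy, rfl⟩ := hx
    refine ⟨X'.smul n (f ⟨y, hy⟩), fun m hm => ?_⟩
    obtain ⟨a, ha⟩ := K.mul_mem_range m hm n hn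
    rw [← X'.mul_smul, ← ha, ← hf]
    refine congrArg f (Subtype.ext ?_)
    change X.smul (K.θ a) y = X.smul m (X.smul n y)
    rw [ha, X.mul_smul]
  | zero =>
    refine ⟨0, fun m hm => ?_⟩
    rw [map_zero, ← map_zero f]
    exact congrArg f (Subtype.ext (map_zero _).symm)
  | add x z _ _ h h' =>
    obtain ⟨x', h⟩ := h
    obtain ⟨z', h'⟩ := h'
    refine ⟨x' + z', fun m hm => ?_⟩
    rw [map_add, h m hm, h' m hm, ← map_add f]
    exact congrArg f (Subtype.ext (map_add _ _ _).symm)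
  | neg x _ h =>
    obtain ⟨x', h⟩ := h
    refine ⟨-x', fun m hm => ?_⟩
    rw [map_neg, h m hm, ← map_neg f]
    exact congrArg f (Subtype.ext (map_neg _ _).symm)

theorem exists_extension_hom {X X' : UnitalModule B} (f : K.sub X →+ X'.carrier)
    (hf : ∀ a (y : K.sub X),
      f ⟨X.smul (K.θ a) y, K.smul_mem_sub X (K.mem_M a) y⟩ = X'.smul (K.θ a) (f y)) :
    ∃ φ : X ⟶ X', ∀ y : K.sub X, φ.toFun y = f y := by
  choose φ hφ using K.exists_extension f hf
  refine ⟨⟨AddMonoidHom.mk' φ fun x z => K.eq_of_smul_eq X' fun m hm => ?_,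
    fun b x => K.eq_of_smul_eq X' fun m hm => ?_⟩, fun y => K.eq_of_smul_eq X' fun m hm => ?_⟩
  · rw [map_add, hφ _ m hm, hφ _ m hm, hφ _ m hm, ← map_add f]
    exact congrArg f (Subtype.ext (map_add _ _ _))
  · change X'.smul m (φ (X.smul b x)) = X'.smul m (X'.smul b (φ x))
    rw [← X'.mul_smul, hφ _ m hm, hφ x _ (K.mul_mem_M m hm b)]
    simp only [X.mul_smul]
  · change X'.smul m (φ y.1) = X'.smul m (f y)
    rw [hφ _ m hm]
    -- `y` is replaced by `u y` with `u` in `A`, since `m u` lies in `A` while `m` need not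
    obtain ⟨i, hi⟩ := (K.eventually_unit_smul_sub X y.2).exists
    obtain ⟨a, ha⟩ := K.mul_mem_range m hm _ (K.mem_N (K.unit i))
    have h1 : f y = X'.smul (K.θ (K.unit i)) (f y) := by
      rw [← hf]
      exact congrArg f (Subtype.ext hi.symm)
    rw [h1, ← X'.mul_smul, ← ha, ← hf]
    refine congrArg f (Subtype.ext ?_)
    change X.smul m y.1 = X.smul (K.θ a) y.1
    rw [ha, X.mul_smul, hi]

instance : K.functor.Full where
  map_surjective {X X'} g := by
    obtain ⟨φ, hφ⟩ := K.exists_extension_hom ((K.sub X').subtype.comp g.toFun)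
      fun a y => congrArg Subtype.val (g.map_smul a y)
    exact ⟨φ, UnitalModule.hom_ext fun y => Subtype.ext (hφ y)⟩

/-! ### The inverse on objects -/

variable (Y : UnitalModule A)

theorem eventually_unit_smul (y : Y.carrier) :
    ∀ᶠ i in K.filter, Y.smul (K.unit i) y = y := by
  have hy : y ∈ AddSubgroup.closure {m : Y.carrier | ∃ a n, Y.smul a n = m} := by
    rw [Y.unital]
    trivial
  induction hy using AddSubgroup.closure_induction with
  | mem y h =>
    obtain ⟨a, z, rfl⟩ := h
    filter_upwards [K.eventually_unit_mul' a] with i hi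
    rw [← Y.mul_smul, hi]
  | zero => exact Filter.Eventually.of_forall fun i => map_zero _
  | add y y' _ _ h h' =>
    filter_upwards [h, h'] with i hi hi'
    rw [map_add, hi, hi']
  | neg y _ h =>
    filter_upwards [h] with i hi
    rw [map_neg, hi]

/-- The function `m ↦ (m n) y` on `M`. -/
noncomputable def tensor (n : K.N) (y : Y.carrier) : K.M →+ Y.carrier :=
  AddMonoidHom.mk' (fun m => Y.smul (K.pair m n) y) fun m m' => by
    rw [pair_add_left, Y.add_smul]

theorem tensor_apply (n : K.N) (y : Y.carrier) (m : K.M) :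
    K.tensor Y n y m = Y.smul (K.pair m n) y := rfl

/-- Right multiplication by `b` on `M`. -/
def mulRight (b : B) : K.M →+ K.M :=
  AddMonoidHom.mk' (fun m => ⟨m * b, K.mul_mem_M m m.2 b⟩) fun m m' =>
    Subtype.ext (add_mul m.1 m'.1 b)

/-- The additive group of functions on `M` generated by the functions `m ↦ (m n) y`.  It is the
quotient of `N ⊗ Y` by the elements that pair to zero with all of `M`. -/
def tensorSub : AddSubgroup (K.M →+ Y.carrier) :=
  AddSubgroup.closure {f | ∃ n y, K.tensor Y n y = f}

theorem tensor_comp_mulRight (n : K.N) (y : Y.carrier) (b : B) :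
    (K.tensor Y n y).comp (K.mulRight b) = K.tensor Y ⟨b * n, K.mul_mem_N b n n.2⟩ y :=
  AddMonoidHom.ext fun m => congrArg (fun a => Y.smul a y) (K.pair_mul_left m b n)

theorem comp_mulRight_mem {f : K.M →+ Y.carrier} (hf : f ∈ K.tensorSub Y) (b : B) :
    f.comp (K.mulRight b) ∈ K.tensorSub Y := by
  induction hf using AddSubgroup.closure_induction with
  | mem f h =>
    obtain ⟨n, y, rfl⟩ := h
    exact AddSubgroup.subset_closure ⟨_, _, (K.tensor_comp_mulRight Y n y b).symm⟩
  | zero => exact zero_mem _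
  | add f f' _ _ h h' => exact add_mem h h'
  | neg f _ h => exact neg_mem h

/-- The `B`-module corresponding to the `A`-module `Y`: `b` acts by `(b f) m = f (m b)`. -/
def induce : UnitalModule B where
  carrier := K.tensorSub Y
  smul :=
    { toFun b := AddMonoidHom.mk' (fun f => ⟨f.1.comp (K.mulRight b), K.comp_mulRight_mem Y f.2 b⟩)
        fun _ _ => rfl
      map_mul' b c := AddMonoidHom.ext fun f => Subtype.ext <| AddMonoidHom.ext fun m =>
        congrArg f.1 (Subtype.ext (mul_assoc m.1 b c).symm)
      map_zero' := AddMonoidHom.ext fun f => Subtype.ext <| AddMonoidHom.ext fun m =>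
        (congrArg f.1 (Subtype.ext (mul_zero m.1))).trans (map_zero f.1)
      map_add' b c := AddMonoidHom.ext fun f => Subtype.ext <| AddMonoidHom.ext fun m =>
        (congrArg f.1 (Subtype.ext (mul_add m.1 b c))).trans
          (map_add f.1 (K.mulRight b m) (K.mulRight c m)) }
  unital := by
    refine (AddSubgroup.eq_top_iff' _).2 fun f => ?_
    obtain ⟨f, hf⟩ := f
    induction hf using AddSubgroup.closure_induction with
    | mem f h =>
      obtain ⟨n, y, rfl⟩ := h
      obtain ⟨i, hi⟩ := (K.eventually_unit_smul Y y).exists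
      refine AddSubgroup.subset_closure ⟨n.1, ⟨K.tensor Y ⟨_, K.mem_N (K.unit i)⟩ y,
        AddSubgroup.subset_closure ⟨_, _, rfl⟩⟩, Subtype.ext ?_⟩
      refine (K.tensor_comp_mulRight Y _ y n.1).trans (AddMonoidHom.ext fun m => ?_)
      rw [tensor_apply, tensor_apply, ← pair_mul, Y.mul_smul, hi]
    | zero => exact zero_mem _
    | add f f' _ _ h h' => exact add_mem h h'
    | neg f _ h => exact neg_mem h
  torsionFree f h := by
    refine Subtype.ext (AddMonoidHom.ext fun m => ?_)
    obtain ⟨i, hi⟩ := (K.eventually_unit_mul m m.2).exists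
    have e : (⟨K.θ (K.unit i) * m, K.mul_mem_M _ (K.mem_M _) _⟩ : K.M) = m := Subtype.ext hi
    rw [← e]
    exact congrArg (fun k => k.1 ⟨_, K.mem_M (K.unit i)⟩) (h m.1)

/-- A left unit for `y`. -/
noncomputable def unitFor (y : Y.carrier) : A :=
  K.unit (K.eventually_unit_smul Y y).exists.choose

theorem unitFor_smul (y : Y.carrier) : Y.smul (K.unitFor Y y) y = y :=
  (K.eventually_unit_smul Y y).exists.choose_spec

/-- The function `m ↦ m y = (m u) y` on `M`, for any `u` in `A` with `u y = y`. -/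
noncomputable def embed (y : Y.carrier) : K.M →+ Y.carrier :=
  K.tensor Y ⟨_, K.mem_N (K.unitFor Y y)⟩ y

/-- The value `(m u) y` does not depend on the choice of `u` with `u y = y`. -/
theorem eventually_embed (y : Y.carrier) (m : K.M) :
    ∀ᶠ i in K.filter, K.embed Y y m = Y.smul (K.pair m ⟨_, K.mem_N (K.unit i)⟩) y := by
  filter_upwards [K.eventually_unit_mul' (K.unitFor Y y)] with i hi
  conv_rhs => rw [← K.unitFor_smul Y y]
  rw [← Y.mul_smul, pair_mul, embed, tensor_apply]
  congr 3
  exact Subtype.ext ((congrArg K.θ hi.symm).trans (map_mul K.θ _ _))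

theorem embed_add (y y' : Y.carrier) : K.embed Y (y + y') = K.embed Y y + K.embed Y y' := by
  ext m
  obtain ⟨i, h1, h2, h3⟩ := ((K.eventually_embed Y (y + y') m).and
    ((K.eventually_embed Y y m).and (K.eventually_embed Y y' m))).exists
  rw [AddMonoidHom.add_apply, h1, h2, h3, map_add]

/-- The function `m ↦ m (a y)` is `m ↦ (m a) y`. -/
theorem embed_smul (a : A) (y : Y.carrier) :
    K.embed Y (Y.smul a y) = K.tensor Y ⟨_, K.mem_N a⟩ y := by
  ext m
  obtain ⟨i, h1, h2⟩ := ((K.eventually_embed Y (Y.smul a y) m).and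
    (K.eventually_unit_mul' a)).exists
  rw [h1, ← Y.mul_smul, pair_mul, tensor_apply]
  congr 3
  exact Subtype.ext ((map_mul K.θ _ _).symm.trans (congrArg K.θ h2))

theorem embed_comp_mulRight (a : A) (y : Y.carrier) :
    (K.embed Y y).comp (K.mulRight (K.θ a)) = K.embed Y (Y.smul a y) := by
  rw [embed_smul, embed, tensor_comp_mulRight]
  ext m
  conv_rhs => rw [← K.unitFor_smul Y y]
  rw [tensor_apply, tensor_apply, ← Y.mul_smul, pair_mul]

theorem embed_mem (y : Y.carrier) : K.embed Y y ∈ K.tensorSub Y :=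
  AddSubgroup.subset_closure ⟨_, _, rfl⟩

theorem embed_mem_sub (y : Y.carrier) :
    (⟨K.embed Y y, K.embed_mem Y y⟩ : (K.induce Y).carrier) ∈ K.sub (K.induce Y) := by
  refine AddSubgroup.subset_closure ⟨_, K.mem_M (K.unitFor Y y), ⟨_, K.embed_mem Y y⟩,
    Subtype.ext ?_⟩
  refine (K.embed_comp_mulRight Y _ y).trans ?_
  rw [K.unitFor_smul Y y]

/-- The homomorphism from `Y` to the `A`-module obtained from the induced `B`-module. -/
noncomputable def embedHom : Y ⟶ K.restrict (K.induce Y) where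
  toFun := AddMonoidHom.mk' (fun y => ⟨⟨K.embed Y y, K.embed_mem Y y⟩, K.embed_mem_sub Y y⟩)
    fun y y' => Subtype.ext (Subtype.ext (K.embed_add Y y y'))
  map_smul a y := Subtype.ext (Subtype.ext (K.embed_comp_mulRight Y a y).symm)

theorem embedHom_injective : Function.Injective (K.embedHom Y).toFun := by
  refine (injective_iff_map_eq_zero _).2 fun y h => ?_
  have h0 : K.embed Y y = 0 := congrArg (fun z => z.1.1) h
  have h1 := DFunLike.congr_fun h0 ⟨_, K.mem_M (K.unitFor Y y)⟩
  rw [embed, tensor_apply, K.pair_eq (a := K.unitFor Y y * K.unitFor Y y) (map_mul _ _ _),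
    Y.mul_smul, K.unitFor_smul, K.unitFor_smul] at h1
  exact h1

theorem embedHom_surjective : Function.Surjective (K.embedHom Y).toFun := by
  rintro ⟨f, hf⟩
  induction hf using AddSubgroup.closure_induction with
  | mem f h =>
    obtain ⟨m, hm, ⟨f, hf⟩, rfl⟩ := h
    induction hf using AddSubgroup.closure_induction with
    | mem f h =>
      obtain ⟨n, y, rfl⟩ := h
      refine ⟨Y.smul (K.pair ⟨m, hm⟩ n) y, Subtype.ext (Subtype.ext ?_)⟩
      refine (K.embed_smul Y _ y).trans (Eq.trans ?_ (K.tensor_comp_mulRight Y n y m).symm)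
      congr 1
      exact Subtype.ext (K.θ_pair ⟨m, hm⟩ n)
    | zero => exact ⟨0, by rw [map_zero]; exact Subtype.ext (map_zero _).symm⟩
    | add f f' hf hf' h h' =>
      obtain ⟨y, h⟩ := h
      obtain ⟨y', h'⟩ := h'
      exact ⟨y + y', by rw [map_add, h, h']; rfl⟩
    | neg f hf h =>
      obtain ⟨y, h⟩ := h
      exact ⟨-y, by rw [map_neg, h]; rfl⟩
  | zero => exact ⟨0, map_zero _⟩
  | add f f' _ _ h h' =>
    obtain ⟨y, h⟩ := h
    obtain ⟨y', h'⟩ := h'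
    exact ⟨y + y', by rw [map_add, h, h']; rfl⟩
  | neg f _ h =>
    obtain ⟨y, h⟩ := h
    exact ⟨-y, by rw [map_neg, h]; rfl⟩

instance : K.functor.EssSurj where
  mem_essImage Y := ⟨K.induce Y,
    ⟨(UnitalModule.isoOfBijective (K.embedHom Y)
      ⟨K.embedHom_injective Y, K.embedHom_surjective Y⟩).symm⟩⟩

instance : K.functor.IsEquivalence where

theorem moritaEquivalent (K : CornerContext A B) : MoritaEquivalent A B where
  idempotent_left := K.isIdempotentRing_left
  idempotent_right := K.isIdempotentRing_right
  equivalence := ⟨K.functor.asEquivalence.symm⟩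

end CornerContext

namespace PartialAction

variable {R : Type w} [CommRing R] {Γ : Type u} [Groupoid.{u} Γ] {C T : PreSemicat.{u} R}
  (α : PartialAction Γ C)

/-! ### Homogeneous elements of the algebra of the skew semicategory -/

open Classical in
/-- The inclusion of a summand in a module of morphisms of `C ⋆ Γ`. -/
noncomputable def skewOf {x : C.Obj} (p : α.Defined x) (y : C.Obj) :
    α.I p.hom (α.obj.act p.hom x) y →ₗ[R] α.SkewHom x y :=
  DirectSum.lof R (α.Defined x) (fun p => α.I p.hom (α.obj.act p.hom x) y) p

theorem skew_comp_skewOf {x y z : C.Obj} (p : α.Defined y) (q : α.Defined x)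
    (f : α.I p.hom (α.obj.act p.hom y) z) (l : α.I q.hom (α.obj.act q.hom x) y) :
    α.skew.comp (α.skewOf p z f) (α.skewOf q y l) =
      α.skewComp₂ p.hom q.hom q.mem p.mem f l := by
  classical
  unfold skewOf skew
  erw [DirectSum.toModule_lof]
  have h2 := DirectSum.toModule_lof R
    (M := fun q : α.Defined x => α.I q.hom (α.obj.act q.hom x) y)
    (φ := fun q : α.Defined x => (α.skewComp₂ p.hom q.hom q.mem p.mem (z := z)).flip) q l
  exact LinearMap.congr_fun h2 f

open Classical in
theorem skewComp₂_eq {a b c : Γ} (t : b ⟶ c) (g : a ⟶ b) {x y z : C.Obj}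
    (hx : x ∈ α.obj.D (inv g)) (hy : y ∈ α.obj.D (inv t)) :
    α.skewComp₂ t g hx hy (z := z) =
      if hxz : x ∈ α.obj.D (inv (g ≫ t)) ∧ z ∈ α.obj.D t then
        (α.skewMul t g hx hy hxz.1 hxz.2).compr₂ (α.skewOf ⟨a, c, g ≫ t, hxz.1⟩ z)
      else 0 := by
  rw [skewComp₂, dif_pos rfl]
  rfl

theorem morph_pull {b c : Γ} (t : b ⟶ c) {y z : C.Obj} (hy : y ∈ α.obj.D (inv t))
    (f : α.I t (α.obj.act t y) z) :
    (⟨_, _, (α.pull t hy f).1⟩ : C.Morph) = (α.semi (inv t)).onMorph ⟨_, _, f.1⟩ := by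
  have hf : f.1 ∈ α.I (inv (inv t)) (α.obj.act t y) z := by
    rw [IsIso.inv_inv]
    exact f.2
  rw [α.onMorph_mk (inv t) hf]
  exact morph_castHom _ _ _

theorem morph_skewMul {a b c : Γ} (t : b ⟶ c) (g : a ⟶ b)
    {x y z : C.Obj} (hx : x ∈ α.obj.D (inv g)) (hy : y ∈ α.obj.D (inv t))
    (hxt : x ∈ α.obj.D (inv (g ≫ t))) (hz : z ∈ α.obj.D t)
    (f : α.I t (α.obj.act t y) z) (l : α.I g (α.obj.act g x) y) :
    (⟨_, _, (α.skewMul t g hx hy hxt hz f l).1⟩ : C.Morph) =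
      (α.semi t).onMorph ⟨_, _, C.comp (α.pull t hy f).1 l.1⟩ := by
  have hm : C.comp (α.pull t hy f).1 l.1 ∈ α.I (inv t) _ _ :=
    (α.compInter t g (α.pull t hy f) l).2.1
  rw [α.onMorph_mk t hm]
  exact morph_castHom _ _ _

/-- The inclusion of a module of morphisms of `C ⋆ Γ` in the algebra. -/
noncomputable def skewIncl (x y : C.Obj) : α.SkewHom x y →ₗ[R] α.skew.Alg := α.skew.single x y

/-- The inclusion of a summand of a module of morphisms of `C ⋆ Γ` in the algebra. -/
noncomputable def skewSingle {x : C.Obj} (p : α.Defined x) (y : C.Obj) :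
    α.I p.hom (α.obj.act p.hom x) y →ₗ[R] α.skew.Alg :=
  (α.skewIncl x y).comp (α.skewOf p y)

theorem skewSingle_mul_of_ne {x y y' z : C.Obj} (h : y' ≠ y) (p : α.Defined y)
    (q : α.Defined x) (f : α.I p.hom (α.obj.act p.hom y) z)
    (l : α.I q.hom (α.obj.act q.hom x) y') :
    α.skewSingle p z f * α.skewSingle q y' l = 0 :=
  single_mul_single_ne α.skew h (α.skewOf p z f) (α.skewOf q y' l)

theorem skewSingle_mul {x y z : C.Obj} (p : α.Defined y) (q : α.Defined x)
    (f : α.I p.hom (α.obj.act p.hom y) z) (l : α.I q.hom (α.obj.act q.hom x) y) :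
    α.skewSingle p z f * α.skewSingle q y l =
      α.skewIncl x z (α.skewComp₂ p.hom q.hom q.mem p.mem f l) := by
  rw [← skew_comp_skewOf]
  exact single_mul_single_eq α.skew (α.skewOf p z f) (α.skewOf q y l)

open Classical in
/-- The homogeneous element `k δ_g` of `a(C ⋆ Γ)` with source `x`, for a morphism `k` in `I g` with
source `g x`; it is zero if `k` is not of this form. -/
noncomputable def delta {a b : Γ} (g : a ⟶ b) (x : C.Obj) (k : C.Morph) : α.skew.Alg :=
  if h : x ∈ α.obj.D (inv g) ∧ k.src = α.obj.act g x ∧ k.hom ∈ α.I g k.src k.tgt then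
    α.skewSingle ⟨a, b, g, h.1⟩ k.tgt
      ⟨C.castHom h.2.1 rfl k.hom, C.castHom_mem (fun x y => α.I g x y) _ _ h.2.2⟩
  else 0

theorem delta_mk {a b : Γ} (g : a ⟶ b) {x y : C.Obj} (hx : x ∈ α.obj.D (inv g))
    {f : C.Hom (α.obj.act g x) y} (hf : f ∈ α.I g _ _) :
    α.delta g x ⟨_, y, f⟩ = α.skewSingle ⟨a, b, g, hx⟩ y ⟨f, hf⟩ := by
  rw [delta, dif_pos ⟨hx, rfl, hf⟩]
  rfl

theorem delta_cases {a b : Γ} (g : a ⟶ b) (x : C.Obj) (k : C.Morph) :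
    α.delta g x k = 0 ∨ x ∈ α.obj.D (inv g) ∧ ∃ y, ∃ f : C.Hom (α.obj.act g x) y,
      f ∈ α.I g _ _ ∧ k = ⟨_, y, f⟩ := by
  by_cases h : x ∈ α.obj.D (inv g) ∧ k.src = α.obj.act g x ∧ k.hom ∈ α.I g k.src k.tgt
  · obtain ⟨s, y, f⟩ := k
    obtain ⟨hx, h1, h2⟩ := h
    dsimp only at h1 h2
    subst h1
    exact Or.inr ⟨hx, y, f, h2, rfl⟩
  · exact Or.inl (dif_neg h)

theorem delta_hom_zero {a b : Γ} (g : a ⟶ b) (x s y : C.Obj) :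
    α.delta g x ⟨s, y, 0⟩ = 0 := by
  obtain h | ⟨hx, y', f, hf, h⟩ := α.delta_cases g x ⟨s, y, 0⟩
  · exact h
  · cases h
    rw [α.delta_mk g hx hf]
    exact map_zero (α.skewSingle ⟨a, b, g, hx⟩ _)

theorem delta_add {a b : Γ} (g : a ⟶ b) {x y : C.Obj} (hx : x ∈ α.obj.D (inv g))
    {f f' : C.Hom (α.obj.act g x) y} (hf : f ∈ α.I g _ _) (hf' : f' ∈ α.I g _ _) :
    α.delta g x ⟨_, y, f + f'⟩ = α.delta g x ⟨_, y, f⟩ + α.delta g x ⟨_, y, f'⟩ := by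
  rw [α.delta_mk g hx hf, α.delta_mk g hx hf', α.delta_mk g hx (add_mem hf hf'), ← map_add]
  rfl

/-- An additive property of elements of `a(C ⋆ Γ)` need only be checked on the `f δ_g`. -/
@[elab_as_elim]
theorem skew_induction {P : α.skew.Alg → Prop} (w : α.skew.Alg) (zero : P 0)
    (add : ∀ v v', P v → P v' → P (v + v'))
    (delta : ∀ {a b : Γ} (g : a ⟶ b) (x y : C.Obj), x ∈ α.obj.D (inv g) →
      ∀ f : C.Hom (α.obj.act g x) y, f ∈ α.I g _ _ → P (α.delta g x ⟨_, y, f⟩)) : P w := by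
  classical
  induction w using α.skew.alg_induction with
  | h0 => exact zero
  | ha v v' h h' => exact add v v' h h'
  | hs x y w =>
    refine DirectSum.induction_on (β := fun p : α.Defined x => α.I p.hom (α.obj.act p.hom x) y)
      (motive := fun w => P (α.skew.single x y w)) w ?_ ?_ ?_
    · exact (map_zero (α.skew.single x y)).symm ▸ zero
    · rintro ⟨a, b, g, hx⟩ ⟨f, hf⟩
      have h := delta g x y hx f hf
      rw [α.delta_mk g hx hf] at h
      exact h
    · intro v v' h h'
      exact (map_add (α.skew.single x y) v v').symm ▸ add _ _ h h'

/-! ### Products of homogeneous elements -/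

theorem delta_mul_of_ne {a b b' c : Γ} (t : b' ⟶ c) (g : a ⟶ b) (h : b ≠ b') (x y : C.Obj)
    (k l : C.Morph) : α.delta t y k * α.delta g x l = 0 := by
  obtain h1 | ⟨hy, z, f, hf, rfl⟩ := α.delta_cases t y k
  · rw [h1, zero_mul]
  obtain h1 | ⟨hx, y', f', hf', rfl⟩ := α.delta_cases g x l
  · rw [h1, mul_zero]
  rw [α.delta_mk t hy hf, α.delta_mk g hx hf']
  by_cases hyy : y' = y
  · subst hyy
    rw [skewSingle_mul, skewComp₂, dif_neg h]
    exact map_zero _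
  · exact α.skewSingle_mul_of_ne hyy _ _ _ _

theorem delta_mul_of_tgt_ne {a b b' c : Γ} (t : b' ⟶ c) (g : a ⟶ b) {x y : C.Obj}
    (k : C.Morph) {l : C.Morph} (h : l.tgt ≠ y) : α.delta t y k * α.delta g x l = 0 := by
  obtain h1 | ⟨hy, z, f, hf, rfl⟩ := α.delta_cases t y k
  · rw [h1, zero_mul]
  obtain h1 | ⟨hx, y', f', hf', rfl⟩ := α.delta_cases g x l
  · rw [h1, mul_zero]
  rw [α.delta_mk t hy hf, α.delta_mk g hx hf']
  exact α.skewSingle_mul_of_ne h _ _ _ _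

theorem delta_mul_of_notMem {a b c : Γ} (t : b ⟶ c) (g : a ⟶ b) {x : C.Obj}
    (h : x ∉ α.obj.D (inv (g ≫ t))) (y : C.Obj) (k l : C.Morph) :
    α.delta t y k * α.delta g x l = 0 := by
  obtain h1 | ⟨hy, z, f, hf, rfl⟩ := α.delta_cases t y k
  · rw [h1, zero_mul]
  obtain h1 | ⟨hx, y', f', hf', rfl⟩ := α.delta_cases g x l
  · rw [h1, mul_zero]
  rw [α.delta_mk t hy hf, α.delta_mk g hx hf']
  by_cases hyy : y' = y
  · subst hyy
    rw [skewSingle_mul, skewComp₂_eq, dif_neg fun h' => h h'.1]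
    exact map_zero _
  · exact α.skewSingle_mul_of_ne hyy _ _ _ _

/-- The product `f δ_t · l δ_g = α^t (p l) δ_{t g}`, where `p = α^{t⁻¹} f`. -/
theorem delta_mul {a b c : Γ} (t : b ⟶ c) (g : a ⟶ b) {x y z w : C.Obj}
    (hx : x ∈ α.obj.D (inv g)) (hy : y ∈ α.obj.D (inv t)) (hxt : x ∈ α.obj.D (inv (g ≫ t)))
    {f : C.Hom (α.obj.act t y) z} (hf : f ∈ α.I t _ _) {l : C.Hom (α.obj.act g x) y}
    (hl : l ∈ α.I g _ _) {p : C.Hom y w}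
    (hp : (α.semi (inv t)).onMorph ⟨_, _, f⟩ = ⟨y, w, p⟩) :
    α.delta t y ⟨_, z, f⟩ * α.delta g x ⟨_, y, l⟩ =
      α.delta (g ≫ t) x ((α.semi t).onMorph ⟨_, _, C.comp p l⟩) := by
  by_cases hf0 : f = 0
  · subst hf0
    have hp0 : p = 0 := by
      rw [PartialSemifunctor.onMorph_zero] at hp
      exact hom_eq_zero_of_eq hp.symm
    subst hp0
    rw [delta_hom_zero, zero_mul, map_zero, LinearMap.zero_apply,
      PartialSemifunctor.onMorph_zero, delta_hom_zero]
  have hz : z ∈ α.obj.D t := (α.mem_D_of_ne_zero _ hf hf0).2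
  rw [α.delta_mk t hy hf, α.delta_mk g hx hl]
  rw [skewSingle_mul, skewComp₂_eq, dif_pos ⟨hxt, hz⟩]
  refine (α.delta_mk (g ≫ t) hxt (α.skewMul t g hx hy hxt hz ⟨f, hf⟩ ⟨l, hl⟩).2).symm.trans ?_
  rw [α.morph_skewMul t g hx hy hxt hz ⟨f, hf⟩ ⟨l, hl⟩]
  refine congrArg (fun k => α.delta (g ≫ t) x ((α.semi t).onMorph k)) (morph_comp_congr ?_ rfl)
  exact (α.morph_pull t hy ⟨f, hf⟩).trans hp

end PartialAction

/-- A map of direct sums along an injective map of indices is injective if it is injective on each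
summand. -/
theorem DirectSum.toModule_lof_injective {R : Type*} [CommRing R] {I J : Type*} [DecidableEq I]
    [DecidableEq J] {M : I → Type*} {N : J → Type*} [∀ i, AddCommGroup (M i)]
    [∀ j, AddCommGroup (N j)] [∀ i, Module R (M i)] [∀ j, Module R (N j)] {e : I → J}
    (he : Function.Injective e) (m : ∀ i, M i →ₗ[R] N (e i))
    (hm : ∀ i, Function.Injective (m i)) :
    Function.Injective (DirectSum.toModule R I (⨁ j, N j)
      fun i => (DirectSum.lof R J N (e i)).comp (m i)) := by
  have key : ∀ (w : ⨁ i, M i) (i : I), DirectSum.component R J N (e i)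
      (DirectSum.toModule R I (⨁ j, N j) (fun i => (DirectSum.lof R J N (e i)).comp (m i)) w) =
      m i (DirectSum.component R I M i w) := by
    intro w i
    induction w using DirectSum.induction_on with
    | zero => simp only [map_zero]
    | add v v' h h' => simp only [map_add, h, h']
    | of i' f =>
      rw [← DirectSum.lof_eq_of R, DirectSum.toModule_lof, LinearMap.comp_apply]
      by_cases h : i' = i
      · subst h
        rw [DirectSum.component.lof_self, DirectSum.component.lof_self]
      · rw [DirectSum.component.of, dif_neg fun h' => h (he h'), DirectSum.component.of, dif_neg h,
          map_zero]
  intro v v' h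
  refine DirectSum.ext_component R fun i => hm i ?_
  rw [← key, ← key, h]

namespace PreSemicat

variable {R : Type w} [CommRing R] {C T : PreSemicat.{u} R}

/-! ### Maps of algebras induced by maps of the modules of morphisms -/

open Classical in
/-- The linear map on `a(C)` given by linear maps on the modules of morphisms. -/
noncomputable def algMap (ι : C.Obj → T.Obj) (m : ∀ x y, C.Hom x y →ₗ[R] T.Hom (ι x) (ι y)) :
    C.Alg →ₗ[R] T.Alg :=
  DirectSum.toModule R (C.Obj × C.Obj) T.Alg fun p => (T.single _ _).comp (m p.1 p.2)

theorem algMap_single (ι : C.Obj → T.Obj) (m : ∀ x y, C.Hom x y →ₗ[R] T.Hom (ι x) (ι y))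
    (x y : C.Obj) (f : C.Hom x y) :
    algMap ι m (C.single x y f) = T.single (ι x) (ι y) (m x y f) := by
  classical
  exact DirectSum.toModule_lof R (M := fun p : C.Obj × C.Obj => C.Hom p.1 p.2) (x, y) f

theorem coeff_algMap {ι : C.Obj → T.Obj} (hι : Function.Injective ι)
    (m : ∀ x y, C.Hom x y →ₗ[R] T.Hom (ι x) (ι y)) (x y : C.Obj) (w : C.Alg) :
    T.coeff (ι x) (ι y) (algMap ι m w) = m x y (C.coeff x y w) := by
  induction w using C.alg_induction with
  | h0 => simp
  | ha a b h h' => simp only [map_add, h, h']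
  | hs x' y' f =>
    rw [algMap_single]
    by_cases h : x' = x ∧ y' = y
    · obtain ⟨rfl, rfl⟩ := h
      rw [coeff_single_self, coeff_single_self]
    · rw [coeff_single_of_ne h, coeff_single_of_ne, map_zero]
      exact fun h' => h ⟨hι h'.1, hι h'.2⟩

theorem algMap_injective {ι : C.Obj → T.Obj} (hι : Function.Injective ι)
    {m : ∀ x y, C.Hom x y →ₗ[R] T.Hom (ι x) (ι y)} (hm : ∀ x y, Function.Injective (m x y)) :
    Function.Injective (algMap ι m) := fun a b h => alg_ext fun x y => hm x y <| by
  rw [← coeff_algMap hι, ← coeff_algMap hι, h]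

end PreSemicat

namespace PartialAction

variable {R : Type w} [CommRing R] {Γ : Type u} [Groupoid.{u} Γ] {C T : PreSemicat.{u} R}
  {α : PartialAction Γ C} {β : PartialAction Γ T}

/-- For a global action, `f δ_t · l δ_g = f β^t(l) δ_{t g}`. -/
theorem IsGlobal.delta_mul (hβ : β.IsGlobal) {a b c : Γ} (t : b ⟶ c) (g : a ⟶ b)
    {x y r s z : T.Obj} {l : T.Morph} (hx : x ∈ β.obj.D (inv g)) (hlx : l.src = β.obj.act g x)
    (hl : l.hom ∈ β.I g l.src l.tgt) (hly : l.tgt = y) (hy : y ∈ β.obj.D (inv t))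
    {F : T.Hom s z} (hF : F ∈ β.I t s z) {L : T.Hom r s}
    (hL : (β.semi t).onMorph l = ⟨r, s, L⟩) :
    β.delta t y ⟨s, z, F⟩ * β.delta g x l = β.delta (g ≫ t) x ⟨r, z, T.comp F L⟩ := by
  obtain ⟨lx, ly, l⟩ := l
  dsimp only at hlx hl hly
  subst hlx hly
  cases hL
  by_cases hF0 : F = 0
  · subst hF0
    rw [delta_hom_zero, zero_mul, map_zero, LinearMap.zero_apply, delta_hom_zero]
  have hD := β.mem_D_of_ne_zero _ hF hF0
  have hgx : β.obj.act g x ∈ β.obj.D (inv t) := by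
    rw [PartialSetAction.IsGlobal.D_eq hβ.obj (inv t)]
    exact β.obj.subset_range g (β.obj.act_mem g hx)
  have hxt : x ∈ β.obj.D (inv (g ≫ t)) := (hβ.obj t g x).1.2 ⟨hx, hgx⟩
  have hl' : l ∈ β.I (inv t) _ _ := by
    rw [hβ.I_eq (inv t), ← hβ.I_eq g]
    exact hl
  obtain ⟨w, p, hp⟩ : ∃ w, ∃ p : T.Hom ly w,
      (β.semi (inv t)).onMorph ⟨_, _, F⟩ = ⟨ly, w, p⟩ :=
    ⟨_, T.castHom (β.obj.act_inv_act t hy) rfl ((β.semi (inv t)).hom F),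
      (morph_castHom _ _ _).symm⟩
  have hpm : p ∈ β.I (inv t) ly w := by
    have h1 := β.hom_mem (inv t) (f := F) (by simpa using hF)
    exact (congrArg (fun k : T.Morph => k.hom ∈ β.I (inv t) k.src k.tgt) hp).mp h1
  rw [β.delta_mul t g hx hy hxt hF hl hp]
  have h2 := β.onMorph_onMorph_inv t hD.1 hD.2 hF
  rw [hp] at h2
  refine congrArg _ ?_
  rw [(β.semi t).onMorph_comp hpm hl']
  exact morph_comp_congr h2 rfl

/-- A nonzero product of homogeneous elements, for composable elements of the groupoid. -/
theorem IsGlobal.delta_mul_cases (hβ : β.IsGlobal) {a b c : Γ} (t : b ⟶ c) (g : a ⟶ b)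
    (x y : T.Obj) (k l : T.Morph) :
    β.delta t y k * β.delta g x l = 0 ∨
      x ∈ β.obj.D (inv (g ≫ t)) ∧ ∃ (r s z : T.Obj) (F : T.Hom s z) (L : T.Hom r s),
        k = ⟨s, z, F⟩ ∧ (β.semi t).onMorph l = ⟨r, s, L⟩ ∧ F ∈ β.I (𝟙 c) s z ∧
        L ∈ β.I (𝟙 c) r s ∧ T.comp F L ≠ 0 ∧ r = β.obj.act (g ≫ t) x ∧
        β.delta t y k * β.delta g x l = β.delta (g ≫ t) x ⟨r, z, T.comp F L⟩ := by
  obtain h | ⟨hy, z, F, hF, rfl⟩ := β.delta_cases t y k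
  · exact Or.inl (by rw [h, zero_mul])
  obtain h | ⟨hx, y', l, hl, rfl⟩ := β.delta_cases g x l
  · exact Or.inl (by rw [h, mul_zero])
  by_cases hyy : y' = y
  swap
  · exact Or.inl (β.delta_mul_of_tgt_ne t g _ hyy)
  subst hyy
  have key := hβ.delta_mul t g (l := ⟨_, y', l⟩) hx rfl hl rfl hy hF rfl
  by_cases h0 : T.comp F ((β.semi t).hom l) = 0
  · refine Or.inl (key.trans ?_)
    rw [h0, delta_hom_zero]
  have hgx : β.obj.act g x ∈ β.obj.D (inv t) := by
    rw [PartialSetAction.IsGlobal.D_eq hβ.obj (inv t)]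
    exact β.obj.subset_range g (β.obj.act_mem g hx)
  have hl' : l ∈ β.I (inv t) _ _ := by
    rw [hβ.I_eq (inv t), ← hβ.I_eq g]
    exact hl
  exact Or.inr ⟨(hβ.obj t g x).1.2 ⟨hx, hgx⟩, _, _, _, F, _, rfl, rfl, β.le_range t _ _ hF,
    β.le_range t _ _ (β.hom_mem t hl'), h0, β.obj.act_act t g x hx hgx, key⟩

namespace Globalization

variable (G : α.Globalization β)

/-! ### The embedding of skew algebras -/

theorem ι_mem_inv {x : C.Obj} {a b : Γ} {g : a ⟶ b} (hx : x ∈ α.obj.D (inv g)) :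
    G.ι x ∈ β.obj.D (inv g) := ((G.universal.mem_iff g x).1 hx).1

/-- The index of a summand in `T ⋆ Γ` attached to the index of a summand in `C ⋆ Γ`. -/
def embDefined {x : C.Obj} (p : α.Defined x) : β.Defined (G.ι x) :=
  ⟨p.dom, p.cod, p.hom, G.ι_mem_inv p.mem⟩

theorem embDefined_injective (x : C.Obj) : Function.Injective (G.embDefined (x := x)) := by
  rintro ⟨a, b, g, hg⟩ ⟨a', b', g', hg'⟩ h
  simp only [embDefined, Defined.mk.injEq] at h ⊢
  exact h

/-- The restriction of `φ_{r(g)}` to the summand of `g`. -/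
noncomputable def embSummand {x : C.Obj} (p : α.Defined x) (y : C.Obj) :
    α.I p.hom (α.obj.act p.hom x) y →ₗ[R]
      β.I p.hom (β.obj.act p.hom (G.ι x)) (G.ι y) :=
  ((T.castHom (G.universal.map_act p.hom x p.mem) rfl).comp
    ((Submodule.subtype _).comp ((G.φ p.cod).comp
      (Submodule.inclusion (α.le_range p.hom _ _))))).codRestrict _ fun f =>
    T.castHom_mem (fun u v => β.I p.hom u v) _ _ (by
      rw [G.global.I_eq p.hom]
      exact Subtype.prop _)

theorem castHom_injective {x x' y y' : T.Obj} (hx : x = x') (hy : y = y') :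
    Function.Injective (T.castHom hx hy) := by
  subst hx hy
  exact Function.injective_id

theorem embSummand_injective {x : C.Obj} (p : α.Defined x) (y : C.Obj) :
    Function.Injective (G.embSummand p y) := fun _ _ h =>
  Submodule.inclusion_injective _ (G.φ_faithful p.cod (Subtype.val_injective
    (castHom_injective _ _ (congrArg Subtype.val h))))

theorem morph_embSummand {x : C.Obj} (p : α.Defined x) (y : C.Obj)
    (f : α.I p.hom (α.obj.act p.hom x) y) :
    (⟨_, _, (G.embSummand p y f).1⟩ : T.Morph) = (G.emb p.cod).onMorph ⟨_, _, f.1⟩ := by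
  rw [G.onMorph_emb p.cod (α.le_range p.hom _ _ f.2)]
  exact morph_castHom _ _ _

open Classical in
/-- The map from the morphisms of `C ⋆ Γ` to those of `T ⋆ Γ`. -/
noncomputable def skewHomMap (x y : C.Obj) : α.SkewHom x y →ₗ[R] β.SkewHom (G.ι x) (G.ι y) :=
  DirectSum.toModule R (α.Defined x) (β.SkewHom (G.ι x) (G.ι y)) fun p =>
    (β.skewOf (G.embDefined p) (G.ι y)).comp (G.embSummand p y)

theorem skewHomMap_skewOf {x : C.Obj} (p : α.Defined x) (y : C.Obj)
    (f : α.I p.hom (α.obj.act p.hom x) y) :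
    G.skewHomMap x y (α.skewOf p y f) =
      β.skewOf (G.embDefined p) (G.ι y) (G.embSummand p y f) := by
  classical
  exact DirectSum.toModule_lof R
    (M := fun p : α.Defined x => α.I p.hom (α.obj.act p.hom x) y) p f

theorem skewHomMap_injective (x y : C.Obj) : Function.Injective (G.skewHomMap x y) := by
  classical
  exact DirectSum.toModule_lof_injective
    (M := fun p : α.Defined x => α.I p.hom (α.obj.act p.hom x) y)
    (N := fun q : β.Defined (G.ι x) => β.I q.hom (β.obj.act q.hom (G.ι x)) (G.ι y))
    (G.embDefined_injective x) (fun p => G.embSummand p y) fun p => G.embSummand_injective p y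

/-- The map from `a(C ⋆ Γ)` to `a(T ⋆ Γ)`. -/
noncomputable def skewMap : α.skew.Alg →ₗ[R] β.skew.Alg :=
  algMap (C := α.skew) (T := β.skew) G.ι fun x y => G.skewHomMap x y

theorem skewMap_injective : Function.Injective G.skewMap :=
  algMap_injective (C := α.skew) (T := β.skew) G.universal.injective
    fun x y => G.skewHomMap_injective x y

theorem skewMap_delta {a b : Γ} (g : a ⟶ b) {x : C.Obj} (hx : x ∈ α.obj.D (inv g))
    {k : C.Morph} (hk : k.src = α.obj.act g x) (hm : k.hom ∈ α.I g k.src k.tgt) :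
    G.skewMap (α.delta g x k) = β.delta g (G.ι x) ((G.emb b).onMorph k) := by
  obtain ⟨s, y, f⟩ := k
  dsimp only at hk hm
  subst hk
  rw [α.delta_mk g hx hm, ← G.morph_embSummand ⟨a, b, g, hx⟩ y ⟨f, hm⟩]
  refine Eq.trans ?_ (β.delta_mk g (G.ι_mem_inv hx)
    (G.embSummand ⟨a, b, g, hx⟩ y ⟨f, hm⟩).2).symm
  refine (algMap_single (C := α.skew) (T := β.skew) G.ι _ x y
    (α.skewOf ⟨a, b, g, hx⟩ y ⟨f, hm⟩)).trans ?_
  exact congrArg (β.skewIncl (G.ι x) (G.ι y)) (G.skewHomMap_skewOf ⟨a, b, g, hx⟩ y ⟨f, hm⟩)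

/-! ### Products with translates of the image of `C` -/

/-- A nonzero composite `φ(f) L` is again in the image of `φ`. -/
theorem onMorph_comp_right (e : Γ) {x y : C.Obj} {f : C.Hom x y} (hf : f ∈ α.I (𝟙 e) x y)
    {r s z : T.Obj} {F : T.Hom s z} {L : T.Hom r s}
    (hF : (G.emb e).onMorph ⟨x, y, f⟩ = ⟨s, z, F⟩) (hL : L ∈ β.I (𝟙 e) r s)
    (h0 : T.comp F L ≠ 0) :
    ∃ x', G.ι x' = r ∧ ∃ f' ∈ α.I (𝟙 e) x' y,
      (⟨r, z, T.comp F L⟩ : T.Morph) = (G.emb e).onMorph ⟨x', y, f'⟩ := by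
  cases hF
  exact G.exists_comp_right e hf hL h0

/-- A nonzero composite `F β^g(φ(f))` is again a translate of an image: it is
`β^g(β^{g⁻¹}(F) φ(f))`. -/
theorem onMorph_comp_left {a b : Γ} (g : a ⟶ b) {x y : C.Obj} {f : C.Hom x y}
    (hf : f ∈ α.I (𝟙 a) x y) {r s z : T.Obj} {F : T.Hom s z} {L : T.Hom r s}
    (hL : (β.semi g).onMorph ((G.emb a).onMorph ⟨x, y, f⟩) = ⟨r, s, L⟩)
    (hF : F ∈ β.I (𝟙 b) s z) (h0 : T.comp F L ≠ 0) :
    ∃ y', ∃ f' ∈ α.I (𝟙 a) x y', f' ≠ 0 ∧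
      (⟨r, z, T.comp F L⟩ : T.Morph) =
        (β.semi g).onMorph ((G.emb a).onMorph ⟨x, y', f'⟩) := by
  cases hL
  have hf0 : f ≠ 0 := by
    rintro rfl
    refine h0 ?_
    have h1 : ((β.semi g).onMorph ((G.emb a).onMorph ⟨x, y, 0⟩)).hom = 0 := by
      rw [PartialSemifunctor.onMorph_zero, PartialSemifunctor.onMorph_zero]
    exact (congrArg _ h1).trans (map_zero _)
  have hF0 : F ≠ 0 := by
    rintro rfl
    simp at h0
  have hfD := α.mem_D_of_ne_zero _ hf hf0
  have hyD : G.ι y ∈ β.obj.D (inv g) := G.ι_mem a hfD.2 _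
  have hFg : F ∈ β.I g _ _ := by
    rw [G.global.I_eq g]
    exact hF
  have hFD := β.mem_D_of_ne_zero _ hFg hF0
  obtain ⟨v, p, hp⟩ : ∃ v, ∃ p : T.Hom (G.ι y) v,
      (β.semi (inv g)).onMorph ⟨_, _, F⟩ = ⟨G.ι y, v, p⟩ :=
    ⟨_, T.castHom (β.obj.act_inv_act g hyD) rfl ((β.semi (inv g)).hom F),
      (morph_castHom _ _ _).symm⟩
  have hpm : p ∈ β.I (inv g) (G.ι y) v := by
    have h1 := β.hom_mem (inv g) (f := F) (by simpa using hFg)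
    exact (congrArg (fun k : T.Morph => k.hom ∈ β.I (inv g) k.src k.tgt) hp).mp h1
  have h2 := β.onMorph_onMorph_inv g hFD.1 hFD.2 hFg
  rw [hp] at h2
  have h3 : (⟨_, z, T.comp F ((β.semi g).hom ((G.emb a).hom f))⟩ : T.Morph) =
      (β.semi g).onMorph ⟨_, _, T.comp p ((G.emb a).hom f)⟩ := by
    rw [(β.semi g).onMorph_comp hpm (G.emb_mem_inv g hf)]
    exact morph_comp_congr h2.symm rfl
  have h4 : T.comp p ((G.emb a).hom f) ≠ 0 := by
    intro h
    rw [h] at h3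
    refine h0 ?_
    rw [PartialSemifunctor.onMorph_zero] at h3
    exact hom_eq_zero_of_eq h3
  obtain ⟨y', -, f', hf', h5⟩ := G.exists_comp_left a hf (β.le_range _ _ _ hpm) h4
  refine ⟨y', f', hf', ?_, h3.trans (congrArg _ h5)⟩
  rintro rfl
  refine h4 ?_
  rw [PartialSemifunctor.onMorph_zero] at h5
  exact hom_eq_zero_of_eq h5

end Globalization

end PartialAction

namespace PartialAction

namespace Globalization

variable {R : Type w} [CommRing R] {Γ : Type u} [Groupoid.{u} Γ] {C T : PreSemicat.{u} R}
  {α : PartialAction Γ C} {β : PartialAction Γ T} (G : α.Globalization β)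

/-- The map `f δ_g ↦ φ(f) δ_g` is multiplicative.  Where `(t g) x` is not defined the product in
`T ⋆ Γ` vanishes as well: a nonzero one would have its source `(t g) ι x` in the image of `ι`. -/
theorem skewMap_delta_mul {a b b' c : Γ} (t : b' ⟶ c) (g : a ⟶ b) (y x : C.Obj) (k l : C.Morph) :
    G.skewMap (α.delta t y k * α.delta g x l) =
      G.skewMap (α.delta t y k) * G.skewMap (α.delta g x l) := by
  obtain h | ⟨hy, z, f, hf, rfl⟩ := α.delta_cases t y k
  · rw [h, zero_mul, map_zero, zero_mul]
  obtain h | ⟨hx, y', l, hl, rfl⟩ := α.delta_cases g x l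
  · rw [h, mul_zero, map_zero, mul_zero]
  rw [G.skewMap_delta t hy rfl hf, G.skewMap_delta g hx rfl hl]
  by_cases hb : b = b'
  swap
  · rw [α.delta_mul_of_ne t g hb, β.delta_mul_of_ne t g hb, map_zero]
  subst hb
  by_cases hyy : y' = y
  swap
  · rw [α.delta_mul_of_tgt_ne t g _ hyy, β.delta_mul_of_tgt_ne t g _ fun h =>
      hyy (G.universal.injective h), map_zero]
  subst hyy
  by_cases hxt : x ∈ α.obj.D (inv (g ≫ t))
  swap
  · rw [α.delta_mul_of_notMem t g hxt, map_zero]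
    obtain h | ⟨hxt', r, s, z', F, L, h1, h2, hF, hL, h0, hr, -⟩ :=
      G.global.delta_mul_cases t g (G.ι x) (G.ι y') ((G.emb c).onMorph ⟨_, z, f⟩)
        ((G.emb b).onMorph ⟨_, y', l⟩)
    · exact h.symm
    · obtain ⟨x', hx', -⟩ := G.onMorph_comp_right c (α.le_range t _ _ hf) h1 hL h0
      exact absurd ((G.universal.mem_iff _ x).2 ⟨hxt', x', hx'.trans hr⟩) hxt
  by_cases hf0 : f = 0
  · subst hf0
    rw [delta_hom_zero, zero_mul, map_zero, PartialSemifunctor.onMorph_zero, delta_hom_zero,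
      zero_mul]
  have hD := α.mem_D_of_ne_zero _ hf hf0
  have hgx := α.obj.act_mem_of_comp t g hx hxt
  obtain ⟨v, p, hp⟩ : ∃ v, ∃ p : C.Hom y' v,
      (α.semi (inv t)).onMorph ⟨_, _, f⟩ = ⟨y', v, p⟩ :=
    ⟨_, C.castHom (α.obj.act_inv_act t hy) rfl ((α.semi (inv t)).hom f),
      (morph_castHom _ _ _).symm⟩
  have hpm : p ∈ α.I (inv t) y' v := by
    have h1 := α.hom_mem (inv t) (f := f) (by simpa using hf)
    exact (congrArg (fun k : C.Morph => k.hom ∈ α.I (inv t) k.src k.tgt) hp).mp h1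
  have hv : v ∈ α.obj.D (inv t) := by
    obtain rfl : α.obj.act (inv t) z = v := congrArg Morph.tgt hp
    exact α.obj.act_mem (inv t) (by simpa using hD.2)
  have hpl : C.comp p l ∈ α.I (inv t) _ _ :=
    α.ideal_range_right _ _ hpm _ (α.le_range g _ _ hl)
  have hpl' : C.comp p l ∈ α.I g _ _ :=
    α.ideal_range_left _ _ (α.le_range (inv t) _ _ hpm) _ hl
  rw [α.delta_mul t g hx hy hxt hf hl hp, G.skewMap_delta (g ≫ t) hxt
    (α.obj.act_act t g x hx hgx) (α.hom_mem_comp t g hpl hpl'), ← G.onMorph_emb_semi t hgx hv hpl]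
  have hl1 := α.le_range g _ _ hl
  have hp1 := α.le_range (inv t) _ _ hpm
  -- the translate by `t` of the image of `p` is the image of `f`
  have hpf : (β.semi t).onMorph ((G.emb b).onMorph ⟨y', v, p⟩) =
      (G.emb c).onMorph ⟨_, z, f⟩ := by
    rw [G.onMorph_emb_semi t hy hv hpm, ← hp, α.onMorph_onMorph_inv t hD.1 hD.2 hf]
  have hs : G.ι (α.obj.act t y') = β.obj.act t (G.ι y') := G.universal.map_act t y' hy
  have key := G.global.delta_mul t g (x := G.ι x) (y := G.ι y')
    (l := (G.emb b).onMorph ⟨_, y', l⟩) (G.ι_mem_inv hx) (G.universal.map_act g x hx)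
    (by rw [G.global.I_eq g]; exact G.emb_mem b hl1) rfl (G.ι_mem_inv hy)
    (F := (G.emb c).hom f) (by rw [G.global.I_eq t]; exact G.emb_mem c (α.le_range t _ _ hf))
    (L := T.castHom rfl hs.symm ((β.semi t).hom ((G.emb b).hom l))) (morph_castHom _ _ _).symm
  refine Eq.trans ?_ key.symm
  refine congrArg _ ?_
  rw [(G.emb b).onMorph_comp hp1 hl1,
    (β.semi t).onMorph_comp (G.emb_mem_inv t hp1) (G.emb_mem_inv t hl1)]
  exact morph_comp_congr hpf (morph_castHom _ _ _).symm

theorem skewMap_mul (v v' : α.skew.Alg) : G.skewMap (v * v') = G.skewMap v * G.skewMap v' := by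
  induction v using α.skew_induction with
  | zero => rw [zero_mul, map_zero, zero_mul]
  | add a b h h' => rw [add_mul, map_add, h, h', map_add, add_mul]
  | delta t y z _ f _ =>
    induction v' using α.skew_induction with
    | zero => rw [mul_zero, map_zero, mul_zero]
    | add a b h h' => rw [mul_add, map_add, h, h', map_add, mul_add]
    | delta g x y' _ l _ => exact G.skewMap_delta_mul t g y x _ _

/-! ### The corner of the skew algebra of the globalization -/

/-- The right ideal of `a(T ⋆ Γ)` generated, as an additive group, by the `φ(f) δ_g` with `f` in `I^{r(g)}`. -/
noncomputable def rightIdeal : AddSubgroup β.skew.Alg :=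
  AddSubgroup.closure {m | ∃ (a b : Γ) (g : a ⟶ b) (u : T.Obj) (x y : C.Obj),
    ∃ f ∈ α.I (𝟙 b) x y, β.delta g u ((G.emb b).onMorph ⟨x, y, f⟩) = m}

/-- The left ideal of `a(T ⋆ Γ)` generated, as an additive group, by the `β^g(φ(f)) δ_g` with `f` in `I^{d(g)}`. -/
noncomputable def leftIdeal : AddSubgroup β.skew.Alg :=
  AddSubgroup.closure {n | ∃ (a b : Γ) (g : a ⟶ b) (x y : C.Obj), ∃ f ∈ α.I (𝟙 a) x y,
    β.delta g (G.ι x) ((β.semi g).onMorph ((G.emb a).onMorph ⟨x, y, f⟩)) = n}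

theorem semi_semi_emb {a b c : Γ} (t : b ⟶ c) (g : a ⟶ b) {x y : C.Obj} {k : C.Hom x y}
    (hk : k ∈ α.I (𝟙 a) x y) (h0 : k ≠ 0) :
    (β.semi t).onMorph ((β.semi g).onMorph ((G.emb a).onMorph ⟨x, y, k⟩)) =
      (β.semi (g ≫ t)).onMorph ((G.emb a).onMorph ⟨x, y, k⟩) := by
  obtain ⟨hx, hy⟩ := α.mem_D_of_ne_zero _ hk h0
  exact β.onMorph_onMorph t g (G.ι_mem a hx _) (G.ι_mem a hy _) (G.ι_mem a hx _)
    (G.ι_mem a hy _) (G.emb_mem_inv g hk) (G.emb_mem_inv (g ≫ t) hk)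

theorem mul_mem_rightIdeal {m : β.skew.Alg} (hm : m ∈ G.rightIdeal) (s : β.skew.Alg) :
    m * s ∈ G.rightIdeal := by
  induction hm using AddSubgroup.closure_induction with
  | zero =>
    rw [zero_mul]
    exact zero_mem _
  | add m m' _ _ h h' =>
    rw [add_mul]
    exact add_mem h h'
  | neg m _ h =>
    rw [neg_mul]
    exact neg_mem h
  | mem m hm =>
    obtain ⟨b', c, t, y, x, x', f, hf, rfl⟩ := hm
    induction s using β.skew_induction with
    | zero =>
      rw [mul_zero]
      exact zero_mem _
    | add v v' h h' =>
      rw [mul_add]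
      exact add_mem h h'
    | @delta a b g u v _ l _ =>
      by_cases hb : b = b'
      swap
      · rw [β.delta_mul_of_ne t g hb]
        exact zero_mem _
      subst hb
      obtain h | ⟨-, r, s, z, F, L, h1, -, -, hL, h0, -, h⟩ :=
        G.global.delta_mul_cases t g u y ((G.emb c).onMorph ⟨x, x', f⟩) ⟨_, v, l⟩
      · rw [h]
        exact zero_mem _
      · obtain ⟨x'', -, f', hf', h3⟩ := G.onMorph_comp_right c hf h1 hL h0
        rw [h, h3]
        exact AddSubgroup.subset_closure ⟨_, _, _, _, _, _, f', hf', rfl⟩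

theorem mul_mem_leftIdeal (s : β.skew.Alg) {n : β.skew.Alg} (hn : n ∈ G.leftIdeal) :
    s * n ∈ G.leftIdeal := by
  induction hn using AddSubgroup.closure_induction with
  | zero =>
    rw [mul_zero]
    exact zero_mem _
  | add m m' _ _ h h' =>
    rw [mul_add]
    exact add_mem h h'
  | neg m _ h =>
    rw [mul_neg]
    exact neg_mem h
  | mem n hn =>
    obtain ⟨a, b, g, x, y, k, hk, rfl⟩ := hn
    by_cases hk0 : k = 0
    · rw [hk0, PartialSemifunctor.onMorph_zero, PartialSemifunctor.onMorph_zero, delta_hom_zero,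
        mul_zero]
      exact zero_mem _
    induction s using β.skew_induction with
    | zero =>
      rw [zero_mul]
      exact zero_mem _
    | add v v' h h' =>
      rw [add_mul]
      exact add_mem h h'
    | @delta b' c t u v _ f _ =>
      by_cases hb : b = b'
      swap
      · rw [β.delta_mul_of_ne t g hb]
        exact zero_mem _
      subst hb
      obtain h | ⟨hxt, r, s, z, F, L, -, h2, hF, -, h0, -, h⟩ :=
        G.global.delta_mul_cases t g (G.ι x) u ⟨_, v, f⟩
          ((β.semi g).onMorph ((G.emb a).onMorph ⟨x, y, k⟩))
      · rw [h]
        exact zero_mem _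
      · rw [G.semi_semi_emb t g hk hk0] at h2
        obtain ⟨y', f', hf', -, h3⟩ := G.onMorph_comp_left (g ≫ t) hk h2 hF h0
        rw [h, h3]
        exact AddSubgroup.subset_closure ⟨_, _, _, _, _, f', hf', rfl⟩

theorem skewMap_mem_rightIdeal (v : α.skew.Alg) : G.skewMap v ∈ G.rightIdeal := by
  induction v using α.skew_induction with
  | zero =>
    rw [map_zero]
    exact zero_mem _
  | add v v' h h' =>
    rw [map_add]
    exact add_mem h h'
  | delta g x y hx f hf =>
    rw [G.skewMap_delta g hx rfl hf]
    exact AddSubgroup.subset_closure ⟨_, _, _, _, _, _, f, α.le_range g _ _ hf, rfl⟩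

theorem skewMap_mem_leftIdeal (v : α.skew.Alg) : G.skewMap v ∈ G.leftIdeal := by
  induction v using α.skew_induction with
  | zero =>
    rw [map_zero]
    exact zero_mem _
  | add v v' h h' =>
    rw [map_add]
    exact add_mem h h'
  | delta g x y hx f hf =>
    rw [G.skewMap_delta g hx rfl hf]
    by_cases h0 : f = 0
    · rw [h0, PartialSemifunctor.onMorph_zero, delta_hom_zero]
      exact zero_mem _
    obtain ⟨h1, h2⟩ := α.mem_D_of_ne_zero _ hf h0
    obtain ⟨f', hf', h⟩ := G.exists_onMorph_eq g h1 h2 hf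
    rw [h]
    refine AddSubgroup.subset_closure ⟨_, _, g, _, _, f', hf', ?_⟩
    exact congrArg (fun x => β.delta g (G.ι x) _) (α.obj.act_inv_act g hx)

/-- The product `φ(f) δ_t · β^g(φ(k)) δ_g = φ(f) β^{t g}(φ(k)) δ_{t g}` comes from `C ⋆ Γ`, since
`φ(I^{r(t)}) ∩ β^{t g}(φ(I^{d(g)})) = φ(I^{t g})`. -/
theorem exists_skewMap_eq_mul {m n : β.skew.Alg} (hm : m ∈ G.rightIdeal)
    (hn : n ∈ G.leftIdeal) : ∃ v, G.skewMap v = m * n := by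
  induction hm using AddSubgroup.closure_induction with
  | zero => exact ⟨0, by rw [zero_mul, map_zero]⟩
  | add m m' _ _ h h' =>
    obtain ⟨v, h⟩ := h
    obtain ⟨v', h'⟩ := h'
    exact ⟨v + v', by rw [map_add, h, h', add_mul]⟩
  | neg m _ h =>
    obtain ⟨v, h⟩ := h
    exact ⟨-v, by rw [map_neg, h, neg_mul]⟩
  | mem m hm =>
    obtain ⟨b', c, t, u, x, y, f, hf, rfl⟩ := hm
    induction hn using AddSubgroup.closure_induction with
    | zero => exact ⟨0, by rw [mul_zero, map_zero]⟩
    | add m m' _ _ h h' =>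
      obtain ⟨v, h⟩ := h
      obtain ⟨v', h'⟩ := h'
      exact ⟨v + v', by rw [map_add, h, h', mul_add]⟩
    | neg m _ h =>
      obtain ⟨v, h⟩ := h
      exact ⟨-v, by rw [map_neg, h, mul_neg]⟩
    | mem n hn =>
      obtain ⟨a, b, g, x', y', k, hk, rfl⟩ := hn
      by_cases hk0 : k = 0
      · exact ⟨0, by rw [hk0, PartialSemifunctor.onMorph_zero, PartialSemifunctor.onMorph_zero,
          delta_hom_zero, mul_zero, map_zero]⟩
      by_cases hb : b = b'
      swap
      · exact ⟨0, by rw [β.delta_mul_of_ne t g hb, map_zero]⟩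
      subst hb
      obtain h | ⟨-, r, s, z, F, L, h1, h2, hF, hL, h0, -, h⟩ :=
        G.global.delta_mul_cases t g (G.ι x') u ((G.emb c).onMorph ⟨x, y, f⟩)
          ((β.semi g).onMorph ((G.emb a).onMorph ⟨x', y', k⟩))
      · exact ⟨0, by rw [h, map_zero]⟩
      -- the product lies in the image of `φ_{r(t)}` and in a translate of the image of `φ_{d(g)}`
      rw [G.semi_semi_emb t g hk hk0] at h2
      obtain ⟨x₁, -, f₁, hf₁, h3⟩ := G.onMorph_comp_right c hf h1 hL h0
      obtain ⟨y₁, k₁, hk₁, hk₁0, h4⟩ := G.onMorph_comp_left (g ≫ t) hk h2 hF h0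
      obtain ⟨hx', hxx, hf₂⟩ := G.mem_of_onMorph_eq (g ≫ t) hf₁ hk₁ hk₁0 (h3.symm.trans h4)
      refine ⟨α.delta (g ≫ t) x' ⟨x₁, y, f₁⟩, ?_⟩
      rw [G.skewMap_delta (g ≫ t) hx' hxx.symm hf₂, h, h3]

/-- `β^h(φ(f)) δ_g = β^h(φ(i)) δ_h · φ(f) δ_{h⁻¹ g}` for a left local identity `i` with `i f = f`, and
the left sides generate the algebra. -/
theorem closure_mul_eq_top (hα : α.HasLeftLocalIdentities) :
    AddSubgroup.closure {s | ∃ n ∈ G.leftIdeal, ∃ m ∈ G.rightIdeal, n * m = s} = ⊤ := by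
  refine (AddSubgroup.eq_top_iff' _).2 fun s => ?_
  induction s using β.skew_induction with
  | zero => exact zero_mem _
  | add v v' h h' => exact add_mem h h'
  | @delta a b g u v hu k hk =>
    refine (G.I_induction g (P := fun k => k ∈ β.I g (β.obj.act g u) v ∧
      β.delta g u ⟨_, v, k⟩ ∈ AddSubgroup.closure
        {s | ∃ n ∈ G.leftIdeal, ∃ m ∈ G.rightIdeal, n * m = s}) ?_ ?_ ?_ hk).2
    · rw [delta_hom_zero]
      exact ⟨zero_mem _, zero_mem _⟩
    · rintro k l ⟨hk, h⟩ ⟨hl, h'⟩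
      refine ⟨add_mem hk hl, ?_⟩
      rw [β.delta_add g hu hk hl]
      exact add_mem h h'
    · intro k c h x y f hf he
      by_cases hf0 : f = 0
      · rw [hf0, PartialSemifunctor.onMorph_zero, PartialSemifunctor.onMorph_zero] at he
        obtain rfl : k = 0 := hom_eq_zero_of_eq he
        rw [delta_hom_zero]
        exact ⟨zero_mem _, zero_mem _⟩
      obtain ⟨hx, hy⟩ := α.mem_D_of_ne_zero _ hf hf0
      obtain ⟨i, hi, hif⟩ := hα c y
      have hk : k ∈ β.I g (β.obj.act g u) v := by
        rw [G.global.I_eq g, ← G.global.I_eq h]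
        exact (congrArg (fun k : T.Morph => k.hom ∈ β.I h k.src k.tgt) he).mpr
          (β.hom_mem h (G.emb_mem_inv h hf))
      refine ⟨hk, AddSubgroup.subset_closure ⟨_, AddSubgroup.subset_closure
        ⟨_, _, h, y, y, i, hi, rfl⟩, _, AddSubgroup.subset_closure
        ⟨_, _, g ≫ inv h, u, x, y, f, hf, rfl⟩, ?_⟩⟩
      have hug : β.obj.act g u = β.obj.act h (G.ι x) := congrArg Morph.src he
      have hD : u ∈ β.obj.D (inv (g ≫ inv h)) := by
        rw [PartialSetAction.IsGlobal.D_eq G.global.obj (inv (g ≫ inv h)),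
          ← PartialSetAction.IsGlobal.D_eq G.global.obj (inv g)]
        exact hu
      have hxh := G.ι_mem c hx (inv h)
      have hsrc : G.ι x = β.obj.act (g ≫ inv h) u := by
        rw [← β.obj.act_act (inv h) g u hu (by
          rw [hug, IsIso.inv_inv]; exact β.obj.act_mem h hxh), hug, β.obj.act_inv_act h hxh]
      have key := G.global.delta_mul h (g ≫ inv h) (x := u) (y := G.ι y)
        (l := (G.emb c).onMorph ⟨x, y, f⟩) hD hsrc
        (by rw [G.global.I_eq (g ≫ inv h)]; exact G.emb_mem c hf) rfl (G.ι_mem c hy (inv h))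
        (β.hom_mem h (G.emb_mem_inv h hi)) rfl
      refine key.trans ?_
      rw [Category.assoc, IsIso.inv_hom_id, Category.comp_id]
      refine congrArg _ ?_
      rw [he]
      refine Eq.trans ((β.semi h).onMorph_comp (G.emb_mem_inv h hi) (G.emb_mem_inv h hf)).symm ?_
      refine congrArg _ ?_
      refine ((G.emb c).onMorph_comp hi hf).symm.trans ?_
      rw [hif x f hf]

/-! ### Local units -/

/-- The sum of the left local identities at finitely many pairs of an identity of the groupoid and
an object of `C`. -/
noncomputable def localUnit (hα : α.HasLeftLocalIdentities) (E : Finset (Γ × C.Obj)) :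
    α.skew.Alg :=
  ∑ p ∈ E, α.delta (𝟙 p.1) p.2 ⟨p.2, p.2, (hα p.1 p.2).choose⟩

theorem skewMap_delta_id (e : Γ) (y : C.Obj) {i : C.Hom y y} (hi : i ∈ α.I (𝟙 e) y y) :
    G.skewMap (α.delta (𝟙 e) y ⟨y, y, i⟩) =
      β.delta (𝟙 e) (G.ι y) ((G.emb e).onMorph ⟨y, y, i⟩) := by
  by_cases h0 : i = 0
  · rw [h0, delta_hom_zero, map_zero, PartialSemifunctor.onMorph_zero, delta_hom_zero]
  have hy := (α.mem_D_of_ne_zero _ hi h0).1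
  exact G.skewMap_delta (𝟙 e) (by simpa using hy) (α.obj.act_id e y hy).symm hi

theorem delta_id_mul {a b : Γ} (g : a ⟶ b) (u : T.Obj) {x y : C.Obj} {f : C.Hom x y}
    (hf : f ∈ α.I (𝟙 b) x y) {i : C.Hom y y} (hi : i ∈ α.I (𝟙 b) y y) (hif : C.comp i f = f) :
    β.delta (𝟙 b) (G.ι y) ((G.emb b).onMorph ⟨y, y, i⟩) *
      β.delta g u ((G.emb b).onMorph ⟨x, y, f⟩) =
      β.delta g u ((G.emb b).onMorph ⟨x, y, f⟩) := by
  by_cases hf0 : f = 0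
  · rw [hf0, PartialSemifunctor.onMorph_zero, delta_hom_zero, mul_zero]
  by_cases hu : u ∈ β.obj.D (inv g) ∧ G.ι x = β.obj.act g u
  swap
  · have h : β.delta g u ((G.emb b).onMorph ⟨x, y, f⟩) = 0 :=
      dif_neg fun h => hu ⟨h.1, h.2.1⟩
    rw [h, mul_zero]
  obtain ⟨hx, hy⟩ := α.mem_D_of_ne_zero _ hf hf0
  have key := G.global.delta_mul (𝟙 b) g (l := (G.emb b).onMorph ⟨x, y, f⟩) hu.1 hu.2
    (by rw [G.global.I_eq g]; exact G.emb_mem b hf) rfl (G.ι_mem b hy (inv (𝟙 b)))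
    (G.emb_mem b hi) (β.onMorph_id b (G.ι_mem b hx (𝟙 b)) (G.ι_mem b hy (𝟙 b)) (G.emb_mem b hf))
  refine key.trans ?_
  rw [Category.comp_id]
  refine congrArg _ (((G.emb b).onMorph_comp hi hf).symm.trans ?_)
  rw [hif]

theorem eventually_localUnit_mul (hα : α.HasLeftLocalIdentities) {m : β.skew.Alg}
    (hm : m ∈ G.rightIdeal) :
    ∀ᶠ E in Filter.atTop, G.skewMap (localUnit hα E) * m = m := by
  classical
  induction hm using AddSubgroup.closure_induction with
  | zero => exact Filter.Eventually.of_forall fun E => mul_zero _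
  | add m m' _ _ h h' =>
    filter_upwards [h, h'] with E hE hE'
    rw [mul_add, hE, hE']
  | neg m _ h =>
    filter_upwards [h] with E hE
    rw [mul_neg, hE]
  | mem m hm =>
    obtain ⟨a, b, g, u, x, y, f, hf, rfl⟩ := hm
    filter_upwards [Filter.eventually_ge_atTop {(b, y)}] with E hE
    obtain ⟨hi, hif⟩ := (hα b y).choose_spec
    rw [localUnit, map_sum, Finset.sum_mul, Finset.sum_eq_single (b, y)]
    · rw [G.skewMap_delta_id b y hi]
      exact G.delta_id_mul g u hf hi (hif x f hf)
    · rintro ⟨e, y'⟩ - hne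
      rw [G.skewMap_delta_id e y' (hα e y').choose_spec.1]
      by_cases hb : b = e
      · subst hb
        exact β.delta_mul_of_tgt_ne (𝟙 b) g _ fun h =>
          hne (Prod.ext rfl (G.universal.injective h).symm)
      · exact β.delta_mul_of_ne (𝟙 e) g hb _ _ _ _
    · intro h
      exact absurd (hE (Finset.mem_singleton_self _)) h

/-- The algebra `a(C ⋆ Γ)` as a corner of `a(T ⋆ Γ)`. -/
noncomputable def cornerContext (hα : α.HasLeftLocalIdentities) [α.IsAssociative]
    [β.IsAssociative] : CornerContext α.skew.Alg β.skew.Alg where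
  θ :=
    { toFun := G.skewMap
      map_mul' := G.skewMap_mul
      map_zero' := map_zero _
      map_add' := map_add _ }
  M := G.rightIdeal
  N := G.leftIdeal
  injective := G.skewMap_injective
  mul_mem_M _ hm s := G.mul_mem_rightIdeal hm s
  mul_mem_N s _ hn := G.mul_mem_leftIdeal s hn
  mem_M := G.skewMap_mem_rightIdeal
  mem_N := G.skewMap_mem_leftIdeal
  mul_mem_range _ hm _ hn := G.exists_skewMap_eq_mul hm hn
  closure_eq_top := G.closure_mul_eq_top hα
  index := Finset (Γ × C.Obj)
  filter := Filter.atTop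
  neBot := inferInstance
  unit := localUnit hα
  eventually_unit_mul _ hm := G.eventually_localUnit_mul hα hm

end Globalization

end PartialAction

theorem mainTheorem3 {R : Type w} [CommRing R] {Γ : Type u} [Groupoid.{u} Γ]
    (C T : PreSemicat.{u} R) [C.IsCategory] [T.IsCategory]
    (α : PartialAction Γ C) (β : PartialAction Γ T) (hglob : α.IsGlobalization β) :
    α.onAlg.IsGlobalization β.onAlg ∧
    (α.HasLeftLocalIdentities → ∀ [α.IsAssociative] [β.IsAssociative],
      MoritaEquivalent α.skew.Alg β.skew.Alg) := by
  obtain ⟨G⟩ := hglob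
  refine ⟨G.onAlg_isGlobalization, fun hα => ?_⟩
  intro _ _
  exact (G.cornerContext hα).moritaEquivalent
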